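/- Let $N,M\ge 1$ be integers, $K=N+M$, and let $A\in\mathbb C^{K\times K}$ be an arbitrary invertible matrix with determinant $|A|$. All functions below depend on real variables $(x,t)\in\mathbb R^2$. For smooth column vectors $\phi,\psi:\mathbb R^2\to\mathbb C^{K}$ let $$|a,\dots,a';\,b,\dots,b'|=\det\bigl(\partial_x^{a}\phi,\partial_x^{a+1}\phi,\dots,\partial_x^{a'}\phi,\ \partial_x^{b}\psi,\partial_x^{b+1}\psi,\dots,\partial_x^{b'}\psi\bigr)$$ denote a double Wronskian ($K$ columns in total; a range with last entry one less than its first entry is empty), and let $D_x,D_t$ be Hirota's bilinear operators, $D_x^mD_t^n\,u\cdot v=(\partial_x-\partial_{x'})^m(\partial_t-\partial_{t'})^n u(x,t)v(x',t')|_{x'=x,\,t'=t}$. (1) Suppose $\phi,\psi$ are smooth and satisfy $$\phi_x=\tfrac i2A^2\phi,\quad \phi_t=-\tfrac14\partial_x^{-1}\phi,\qquad \psi_x=-\tfrac i2A^2\psi,\quad \psi_t=-\tfrac14\partial_x^{-1}\psi,$$ where $u_t=-\tfrac14\partial_x^{-1}u$ means that $u_t=-\tfrac14 U$ for some $U$ with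 $\partial_xU=u$. Put $$f=|1,\dots,N;0,\dots,M-1|,\qquad s=|1,\dots,N;1,\dots,M|,$$ $$g=\frac{1}{2(2i)^{N-1}}|A|\,|0,\dots,N;1,\dots,M-1|,\qquad h=-i(2i)^{N-1}|A|^{-1}|2,\dots,N;0,\dots,M|,$$ $$\tilde h=-\frac1{(2i)^{N-1}}|A|\,|0,\dots,N;0,\dots,M-2|,\qquad \bar h=-(2i)^N|A|^{-1}|2,\dots,N;1,\dots,M+1|.$$ Then $f,g,h,s,\tilde h,\bar h$ are smooth and satisfy on all of $\mathbb R^2$ the bilinear equations $$B_1=D_t\tilde h\cdot s+gf=0,\quad B_2=D_t\bar h\cdot f+hs=0,\quad B_3=D_tf\cdot s+igh=0,$$ $$B_4=D_xg\cdot f-\tilde hs=0,\quad B_5=D_xh\cdot s-\bar hf=0,\quad B_6=D_xf\cdot s-i\tilde h\bar h=0.$$ Moreover, on the open set where $f\ne0$ and $s\ne0$, the functions $$q_1=\frac{\tilde h}{f},\quad q_2=\frac{\bar h}{s},\quad q_3=i\frac gs,\quad q_4=-i\frac hf$$ are smooth and solve the unreduced (four-component) massive Thirring model $$iq_{1,t}+q_3+q_1q_3q_4=0,\quad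 iq_{2,t}-q_4-q_2q_3q_4=0,\quad iq_{3,x}+q_1+q_1q_2q_3=0,\quad iq_{4,x}-q_2-q_1q_2q_4=0.$$ (2) For arbitrary constant vectors $B,C\in\mathbb C^{K}$ the explicit vectors $$\phi=\exp\bigl(\tfrac i2A^2x+\tfrac i2A^{-2}t\bigr)C,\qquad \psi=\exp\bigl(-\tfrac i2A^2x-\tfrac i2A^{-2}t\bigr)B$$ are smooth and satisfy the conditions of (1). (3) A matrix similar to $A$ leads to the same $q_1,\dots,q_4$: if $P$ is invertible and $A'=PAP^{-1}$, then for all $B,C\in\mathbb C^K$ the functions $q_1,\dots,q_4$ obtained as above from $(A',PB,PC)$ coincide with those obtained from $(A,B,C)$, and the sets where $f\neq0$ and $s\ne0$ are the same. -/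

import Mathlib

open scoped Matrix ContDiff

noncomputable section

namespace MTM

/-- Smoothness of a function of the two real variables `(x, t)`. -/
def Smooth {E : Type*} [NormedAddCommGroup E] [NormedSpace ℝ E] (u : ℝ → ℝ → E) : Prop :=
  ContDiff ℝ ∞ (fun p : ℝ × ℝ => u p.1 p.2)

/-- Partial derivative in the first variable `x`. -/
def dx (u : ℝ → ℝ → ℂ) (x t : ℝ) : ℂ := deriv (fun y => u y t) x

/-- Partial derivative in the second variable `t`. -/
def dt (u : ℝ → ℝ → ℂ) (x t : ℝ) : ℂ := deriv (fun τ => u x τ) t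

/-! ### Hirota's bilinear operator -/

/-- The operator `∂_x - ∂_{x'}` on functions of `(x, t, x', t')`. -/
def hirotaX (F : ℝ → ℝ → ℝ → ℝ → ℂ) : ℝ → ℝ → ℝ → ℝ → ℂ := fun x t x' t' =>
  deriv (fun y => F y t x' t') x - deriv (fun y => F x t y t') x'

/-- The operator `∂_t - ∂_{t'}` on functions of `(x, t, x', t')`. -/
def hirotaT (F : ℝ → ℝ → ℝ → ℝ → ℂ) : ℝ → ℝ → ℝ → ℝ → ℂ := fun x t x' t' =>
  deriv (fun τ => F x τ x' t') t - deriv (fun τ => F x t x' τ) t'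

/-- `D_x^m D_t^n u · v = (∂_x - ∂_{x'})^m (∂_t - ∂_{t'})^n u(x,t) v(x',t')` at
`x' = x`, `t' = t`. -/
def hirotaD (m n : ℕ) (u v : ℝ → ℝ → ℂ) (x t : ℝ) : ℂ :=
  (hirotaX^[m] (hirotaT^[n] (fun x t x' t' => u x t * v x' t'))) x t x t

/-! ### The unreduced massive Thirring model and its bilinear form -/

/-- The smooth functions `f, g, h, s, ht, hb` of `(x, t)` (`ht` is h-tilde, `hb` is h-bar) solve
the bilinear equations `B₁ = ⋯ = B₆ = 0` on the whole plane. -/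
structure IsBilinearSolution (f g h s ht hb : ℝ → ℝ → ℂ) : Prop where
  smooth_f : Smooth f
  smooth_g : Smooth g
  smooth_h : Smooth h
  smooth_s : Smooth s
  smooth_ht : Smooth ht
  smooth_hb : Smooth hb
  B1 : ∀ x t, hirotaD 0 1 ht s x t + g x t * f x t = 0
  B2 : ∀ x t, hirotaD 0 1 hb f x t + h x t * s x t = 0
  B3 : ∀ x t, hirotaD 0 1 f s x t + Complex.I * g x t * h x t = 0
  B4 : ∀ x t, hirotaD 1 0 g f x t - ht x t * s x t = 0
  B5 : ∀ x t, hirotaD 1 0 h s x t - hb x t * f x t = 0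
  B6 : ∀ x t, hirotaD 1 0 f s x t - Complex.I * ht x t * hb x t = 0

/-- The functions `q₁, …, q₄` are smooth on the open set `U` of the `(x, t)`-plane and solve the
unreduced (four-component) massive Thirring model there. -/
structure IsMTMSolutionOn (U : Set (ℝ × ℝ)) (q₁ q₂ q₃ q₄ : ℝ → ℝ → ℂ) : Prop where
  isOpen : IsOpen U
  smooth₁ : ContDiffOn ℝ ∞ (fun p : ℝ × ℝ => q₁ p.1 p.2) U
  smooth₂ : ContDiffOn ℝ ∞ (fun p : ℝ × ℝ => q₂ p.1 p.2) U
  smooth₃ : ContDiffOn ℝ ∞ (fun p : ℝ × ℝ => q₃ p.1 p.2) U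
  smooth₄ : ContDiffOn ℝ ∞ (fun p : ℝ × ℝ => q₄ p.1 p.2) U
  eq₁ : ∀ x t, (x, t) ∈ U →
    Complex.I * dt q₁ x t + q₃ x t + q₁ x t * q₃ x t * q₄ x t = 0
  eq₂ : ∀ x t, (x, t) ∈ U →
    Complex.I * dt q₂ x t - q₄ x t - q₂ x t * q₃ x t * q₄ x t = 0
  eq₃ : ∀ x t, (x, t) ∈ U →
    Complex.I * dx q₃ x t + q₁ x t + q₁ x t * q₂ x t * q₃ x t = 0
  eq₄ : ∀ x t, (x, t) ∈ U →
    Complex.I * dx q₄ x t - q₂ x t - q₁ x t * q₂ x t * q₄ x t = 0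

/-! ### Double Wronskians -/

/-- The `K × K` double Wronskian with columns
`∂_x^a φ, ∂_x^(a+1) φ, …, ∂_x^(a+p-1) φ; ∂_x^b ψ, ∂_x^(b+1) ψ, …, ∂_x^(b+K-p-1) ψ`:
`p` consecutive columns of derivatives of `φ` starting with order `a`, and then `K - p`
consecutive columns of derivatives of `ψ` starting with order `b`. -/
def doubleWronskian {K : ℕ} (φ ψ : ℝ → ℝ → Fin K → ℂ) (a p b : ℕ) (x t : ℝ) : ℂ :=
  Matrix.det (Matrix.of fun i j : Fin K =>
    if (j : ℕ) < p then iteratedDeriv (a + j) (fun y => φ y t) x i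
    else iteratedDeriv (b + (j - p)) (fun y => ψ y t) x i)

section tau

variable (N M : ℕ) (A : Matrix (Fin (N + M)) (Fin (N + M)) ℂ)
  (φ ψ : ℝ → ℝ → Fin (N + M) → ℂ)

/-- `f = |1,…,N; 0,…,M-1|`. -/
def tauF : ℝ → ℝ → ℂ := doubleWronskian φ ψ 1 N 0

/-- `g = (2 (2i)^(N-1))⁻¹ |A| |0,…,N; 1,…,M-1|`. -/
def tauG (x t : ℝ) : ℂ :=
  1 / (2 * (2 * Complex.I) ^ (N - 1)) * A.det * doubleWronskian φ ψ 0 (N + 1) 1 x t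

/-- `h = -i (2i)^(N-1) |A|⁻¹ |2,…,N; 0,…,M|`. -/
def tauH (x t : ℝ) : ℂ :=
  -Complex.I * (2 * Complex.I) ^ (N - 1) * A.det⁻¹ * doubleWronskian φ ψ 2 (N - 1) 0 x t

/-- `s = |1,…,N; 1,…,M|`. -/
def tauS : ℝ → ℝ → ℂ := doubleWronskian φ ψ 1 N 1

/-- h-tilde `= -((2i)^(N-1))⁻¹ |A| |0,…,N; 0,…,M-2|`. -/
def tauHt (x t : ℝ) : ℂ :=
  -(1 / (2 * Complex.I) ^ (N - 1)) * A.det * doubleWronskian φ ψ 0 (N + 1) 0 x t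

/-- h-bar `= -(2i)^N |A|⁻¹ |2,…,N; 1,…,M+1|`. -/
def tauHb (x t : ℝ) : ℂ :=
  -(2 * Complex.I) ^ N * A.det⁻¹ * doubleWronskian φ ψ 2 (N - 1) 1 x t

/-- `q₁ = ht / f`. -/
def q₁ (x t : ℝ) : ℂ := tauHt N M A φ ψ x t / tauF N M φ ψ x t

/-- `q₂ = hb / s`. -/
def q₂ (x t : ℝ) : ℂ := tauHb N M A φ ψ x t / tauS N M φ ψ x t

/-- `q₃ = i g / s`. -/
def q₃ (x t : ℝ) : ℂ := Complex.I * (tauG N M A φ ψ x t / tauS N M φ ψ x t)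

/-- `q₄ = -i h / f`. -/
def q₄ (x t : ℝ) : ℂ := -Complex.I * (tauH N M A φ ψ x t / tauF N M φ ψ x t)

/-- The set of points at which `q₁, …, q₄` are defined: `f ≠ 0` and `s ≠ 0`. -/
def domain : Set (ℝ × ℝ) := {p | tauF N M φ ψ p.1 p.2 ≠ 0 ∧ tauS N M φ ψ p.1 p.2 ≠ 0}

end tau

/-! ### The elementary column vectors -/

/-- The linear conditions `φ_x = c A² φ` and `φ_t = -(1/4) ∂_x⁻¹ φ` on a smooth vector function
`φ`, where `∂_x⁻¹ φ` is a function `Φ` with `∂_x Φ = φ`. -/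
structure IsElementary {K : ℕ} (c : ℂ) (A : Matrix (Fin K) (Fin K) ℂ)
    (φ : ℝ → ℝ → Fin K → ℂ) : Prop where
  smooth : Smooth φ
  x_eq : ∀ x t, HasDerivAt (fun y => φ y t) (c • (A ^ 2 *ᵥ φ x t)) x
  t_eq : ∃ Φ : ℝ → ℝ → Fin K → ℂ,
    (∀ x t, HasDerivAt (fun y => Φ y t) (φ x t) x) ∧
    ∀ x t, HasDerivAt (fun τ => φ x τ) (-(1 / 4 : ℂ) • Φ x t) t

/-- `exp((i/2) A² x + (i/2) A⁻² t) C`. -/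
def phi {K : ℕ} (A : Matrix (Fin K) (Fin K) ℂ) (C : Fin K → ℂ) (x t : ℝ) : Fin K → ℂ :=
  NormedSpace.exp ((Complex.I / 2 * (x : ℂ)) • A ^ 2 + (Complex.I / 2 * (t : ℂ)) • A⁻¹ ^ 2) *ᵥ C

/-- `exp(-(i/2) A² x - (i/2) A⁻² t) B`. -/
def psi {K : ℕ} (A : Matrix (Fin K) (Fin K) ℂ) (B : Fin K → ℂ) (x t : ℝ) : Fin K → ℂ :=
  NormedSpace.exp (-((Complex.I / 2 * (x : ℂ)) • A ^ 2) - (Complex.I / 2 * (t : ℂ)) • A⁻¹ ^ 2)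
    *ᵥ B

end MTM

end

/-! Put L = (i/2)A². On elementary vectors ∂_x acts as L on φ and as -L on ψ. Equality of mixed
partials identifies the antiderivative with L⁻¹φ, resp. -L⁻¹ψ, so ∂_t acts as T = -L⁻¹/4 on φ and as
-T on ψ. All columns are then u_j = L^j φ and v_j = (-L)^j ψ with j ∈ ℤ, and the bilinear equations
become identities between determinants of such columns.

Differentiating a determinant column by column gives weights +1 on the u-block and -1 on the
v-block. With equal weights the sum would be a trace times the determinant
(`sum_det_updateCol_mulVec`). Subtracting plus or minus that multiple removes one block; in the
other, shifting an inner column repeats its neighbour, so only one displaced end column survives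
(`hasDerivAt_columnDet`). The trace terms cancel in the antisymmetric Hirota derivative.

What is left of each equation is the three-term relation `columnDet_plucker` for a common block of K
- 2 columns and four further columns. In four of the six equations some determinants must first be
brought to that block by applying L to every column, at the cost of det L and a sign
(`columnDet_segment_shift`).

The model follows by the quotient rule. Commuting exponentials solve the linear conditions directly.
Under conjugation by P every Wronskian is multiplied by det P, which drops out of the quotients,
while |A| does not change. -/

noncomputable section

namespace MTM

/-! ### Determinants of lists of columns and the Plücker relation -/

variable {K : ℕ}

/-- The determinant whose columns are the first `K` entries of a list. -/
def columnDet (l : List (Fin K → ℂ)) : ℂ :=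
  Matrix.det (Matrix.of fun i j : Fin K => l.getD j 0 i)

theorem columnDet_map (L : Matrix (Fin K) (Fin K) ℂ) (l : List (Fin K → ℂ)) :
    columnDet (l.map (L *ᵥ ·)) = L.det * columnDet l := by
  unfold columnDet
  rw [← Matrix.det_mul]
  congr 1
  ext i j
  -- The default column 0 is fixed by `L`, so the length of `l` plays no role.
  have h := List.getD_map (l := l) (n := (j : ℕ)) (d := (0 : Fin K → ℂ)) (fun w => L *ᵥ w)
  simp only [Matrix.mulVec_zero] at h
  simp only [Matrix.of_apply, h, Matrix.mul_apply, Matrix.mulVec, dotProduct]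

/-- A Cramer coordinate overwrites its column, so `y` is only a placeholder. The choice `y = 0`
yields linearity in one column; other choices give the coefficients in the Plücker relation. -/
theorem columnDet_append_cons_eq_cramer (l₁ l₂ : List (Fin K → ℂ)) (y x : Fin K → ℂ)
    (h : l₁.length < K) :
    columnDet (l₁ ++ x :: l₂) =
      Matrix.cramer (Matrix.of fun i j : Fin K => (l₁ ++ y :: l₂).getD j 0 i) x
        ⟨l₁.length, h⟩ := by
  rw [Matrix.cramer_apply]
  unfold columnDet
  congr 1
  ext i j
  rw [Matrix.updateCol_apply]
  split_ifs with hj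
  · subst hj; simp
  · have hj' : (j : ℕ) ≠ l₁.length := fun h' => hj (Fin.ext h')
    simp only [Matrix.of_apply]
    rcases lt_or_gt_of_ne hj' with h' | h'
    · rw [List.getD_append _ _ _ _ h', List.getD_append _ _ _ _ h']
    · rw [List.getD_append_right _ _ _ _ h'.le, List.getD_append_right _ _ _ _ h'.le]
      obtain ⟨k, hk⟩ : ∃ k, (j : ℕ) - l₁.length = k + 1 := ⟨j - l₁.length - 1, by omega⟩
      simp [hk]

/-- `columnDet` as a linear function of one of its columns. -/
def columnDetLinear (l₁ l₂ : List (Fin K → ℂ)) (h : l₁.length < K) : (Fin K → ℂ) →ₗ[ℂ] ℂ :=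
  (LinearMap.proj ⟨l₁.length, h⟩).comp
    (Matrix.cramer (Matrix.of fun i j : Fin K => (l₁ ++ 0 :: l₂).getD j 0 i))

theorem columnDetLinear_apply (l₁ l₂ : List (Fin K → ℂ)) (h : l₁.length < K) (x : Fin K → ℂ) :
    columnDetLinear l₁ l₂ h x = columnDet (l₁ ++ x :: l₂) :=
  (columnDet_append_cons_eq_cramer l₁ l₂ 0 x h).symm

theorem columnDet_eq_zero_of_eq (l : List (Fin K → ℂ)) {i j : ℕ} (hi : i < K) (hj : j < K)
    (hij : i ≠ j) (h : l.getD i 0 = l.getD j 0) : columnDet l = 0 := by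
  refine Matrix.det_zero_of_column_eq (i := ⟨i, hi⟩) (j := ⟨j, hj⟩) (by simpa using hij) ?_
  intro k
  simp only [Matrix.of_apply, h]

theorem getD_append_cons_cons_swap (l₁ l₂ : List (Fin K → ℂ)) (a b : Fin K → ℂ) (k : ℕ) :
    (l₁ ++ a :: b :: l₂).getD k 0 =
      (l₁ ++ b :: a :: l₂).getD (Equiv.swap l₁.length (l₁.length + 1) k) 0 := by
  rcases lt_or_ge k l₁.length with h | h
  · rw [Equiv.swap_apply_of_ne_of_ne (by omega) (by omega), List.getD_append _ _ _ _ h,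
      List.getD_append _ _ _ _ h]
  · obtain ⟨r, rfl⟩ := Nat.exists_eq_add_of_le h
    rcases r with _ | _ | r
    · simp
    · simp
    · rw [Equiv.swap_apply_of_ne_of_ne (by omega) (by omega),
        List.getD_append_right _ _ _ _ (by omega), List.getD_append_right _ _ _ _ (by omega)]
      have : l₁.length + (r + 1 + 1) - l₁.length = r + 1 + 1 := by omega
      simp [this]

theorem columnDet_swap (l₁ l₂ : List (Fin K → ℂ)) (a b : Fin K → ℂ) (h : l₁.length + 1 < K) :
    columnDet (l₁ ++ a :: b :: l₂) = -columnDet (l₁ ++ b :: a :: l₂) := by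
  have hs := Matrix.det_permute'
    (Equiv.swap (⟨l₁.length, by omega⟩ : Fin K) ⟨l₁.length + 1, h⟩)
    (Matrix.of fun i j : Fin K => (l₁ ++ b :: a :: l₂).getD j 0 i)
  rw [Equiv.Perm.sign_swap (by simp)] at hs
  unfold columnDet
  rw [← neg_one_mul]
  refine Eq.trans ?_ (hs.trans (by simp))
  congr 1
  ext i j
  simp only [Matrix.of_apply, Matrix.submatrix_apply, id]
  rw [getD_append_cons_cons_swap]
  simp only [Equiv.swap_apply_def, Fin.ext_iff]
  split_ifs <;> rfl

theorem columnDet_move (l₁ P l₂ : List (Fin K → ℂ)) (a : Fin K → ℂ)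
    (h : l₁.length + P.length < K) :
    columnDet (l₁ ++ a :: (P ++ l₂)) = (-1) ^ P.length * columnDet (l₁ ++ (P ++ a :: l₂)) := by
  induction P generalizing l₁ with
  | nil => simp
  | cons b P ih =>
    have h' : l₁.length + (P.length + 1) < K := by simpa using h
    have := ih (l₁ ++ [b]) (by simp; omega)
    simp only [List.append_assoc, List.cons_append, List.nil_append] at this
    rw [List.cons_append, columnDet_swap _ _ _ _ (by omega), this]
    simp [pow_succ]

/-- The three-term Plücker relation. -/
theorem columnDet_plucker (P Q : List (Fin K → ℂ)) (a b c d : Fin K → ℂ)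
    (h : P.length + 1 < K) :
    columnDet (P ++ a :: b :: Q) * columnDet (P ++ c :: d :: Q)
      - columnDet (P ++ a :: c :: Q) * columnDet (P ++ b :: d :: Q)
      + columnDet (P ++ a :: d :: Q) * columnDet (P ++ b :: c :: Q) = 0 := by
  set M : Matrix (Fin K) (Fin K) ℂ :=
    Matrix.of fun i j : Fin K => (P ++ c :: d :: Q).getD j 0 i with hM
  have hl : (P ++ [a]).length < K := by simpa using h
  set F := columnDetLinear (P ++ [a]) Q hl with hF
  have hFa : ∀ x, F x = columnDet (P ++ a :: x :: Q) := fun x => by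
    rw [hF, columnDetLinear_apply]; simp
  -- Cramer's rule, valid also for singular `M`, expands det M · b in the columns P, c, d, Q.
  -- Applying `F` = det(P, a, ·, Q) kills the columns from P and Q, so only the c and d terms
  -- remain.
  have hcr : M *ᵥ M.cramer b = M.det • b := Matrix.mulVec_cramer M b
  have hsum : M *ᵥ M.cramer b =
      ∑ j : Fin K, M.cramer b j • (P ++ c :: d :: Q).getD (j : ℕ) 0 := by
    ext i
    simp [Matrix.mulVec, dotProduct, hM, Finset.sum_apply, mul_comm]
  have h0 : ∀ j : Fin K, j ≠ ⟨P.length, by omega⟩ → j ≠ ⟨P.length + 1, h⟩ →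
      F ((P ++ c :: d :: Q).getD (j : ℕ) 0) = 0 := by
    intro j h1 h2
    have h1' : (j : ℕ) ≠ P.length := fun e => h1 (Fin.ext e)
    have h2' : (j : ℕ) ≠ P.length + 1 := fun e => h2 (Fin.ext e)
    rw [hFa]
    refine columnDet_eq_zero_of_eq _ j.2 h h2' ?_
    have e1 : ∀ z : Fin K → ℂ, (P ++ a :: z :: Q).getD (P.length + 1) 0 = z := by
      intro z; simp
    rw [e1]
    rcases lt_or_gt_of_ne h1' with h' | h'
    · rw [List.getD_append _ _ _ _ h', List.getD_append _ _ _ _ h']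
    · obtain ⟨r, hr⟩ : ∃ r, (j : ℕ) = P.length + (r + 2) := ⟨j - P.length - 2, by omega⟩
      have tail : ∀ x y : Fin K → ℂ,
          (P ++ x :: y :: Q).getD (P.length + (r + 2)) 0 = Q.getD r 0 := by
        intro x y
        rw [List.getD_append_right _ _ _ _ (by omega), Nat.add_sub_cancel_left]
        simp
      rw [hr, tail, tail]
  have key := congrArg F hcr
  rw [hsum, map_sum, map_smul, hFa, Finset.sum_eq_add_of_mem (⟨P.length, by omega⟩ : Fin K)
    ⟨P.length + 1, h⟩ (Finset.mem_univ _) (Finset.mem_univ _) (by simp)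
    (fun j _ hj => by rw [map_smul, h0 j hj.1 hj.2, smul_zero])] at key
  have c1 : M.cramer b ⟨P.length, by omega⟩ = columnDet (P ++ b :: d :: Q) :=
    (columnDet_append_cons_eq_cramer P (d :: Q) c b (by omega)).symm
  have c2 : M.cramer b ⟨P.length + 1, h⟩ = columnDet (P ++ c :: b :: Q) := by
    have := columnDet_append_cons_eq_cramer (P ++ [c]) Q d b (by simpa using h)
    simp only [List.append_assoc, List.cons_append, List.nil_append] at this
    rw [this, hM]
    exact congrArg _ (Fin.ext (by simp))
  have hdet : M.det = columnDet (P ++ c :: d :: Q) := rfl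
  rw [map_smul, map_smul, hFa, hFa, c1, c2, hdet, columnDet_swap P Q c b h] at key
  have e0 : (P ++ c :: d :: Q).getD P.length 0 = c := by simp
  have e1 : (P ++ c :: d :: Q).getD (P.length + 1) 0 = d := by simp
  simp only [e0, e1, smul_eq_mul] at key
  linear_combination -key

theorem columnDet_smul (l₁ l₂ : List (Fin K → ℂ)) (r : ℂ) (x : Fin K → ℂ) (h : l₁.length < K) :
    columnDet (l₁ ++ (r • x) :: l₂) = r * columnDet (l₁ ++ x :: l₂) := by
  rw [← columnDetLinear_apply _ _ h, map_smul, columnDetLinear_apply, smul_eq_mul]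

theorem columnDet_append_map_neg (l₁ l₂ : List (Fin K → ℂ)) (h : l₁.length + l₂.length ≤ K) :
    columnDet (l₁ ++ l₂.map (fun w => -w)) = (-1) ^ l₂.length * columnDet (l₁ ++ l₂) := by
  induction l₂ generalizing l₁ with
  | nil => simp
  | cons a l ih =>
    have h' : l₁.length + (l.length + 1) ≤ K := by simpa using h
    have := ih (l₁ ++ [-a]) (by simp; omega)
    simp only [List.append_assoc, List.cons_append, List.nil_append] at this
    rw [List.map_cons, this, ← neg_one_smul ℂ a, columnDet_smul _ _ _ _ (by omega)]
    simp [pow_succ]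

/-- Applying `L` to the first columns and `-L` to the remaining ones. -/
theorem columnDet_map_append_map_neg (L : Matrix (Fin K) (Fin K) ℂ) (l₁ l₂ : List (Fin K → ℂ))
    (h : l₁.length + l₂.length ≤ K) :
    columnDet (l₁.map (L *ᵥ ·) ++ l₂.map (fun w => -(L *ᵥ w))) =
      L.det * (-1) ^ l₂.length * columnDet (l₁ ++ l₂) := by
  have := columnDet_append_map_neg (l₁.map (L *ᵥ ·)) (l₂.map (L *ᵥ ·)) (by simpa using h)
  rw [List.map_map] at this
  rw [show (fun w => -(L *ᵥ w)) = (fun w => -w) ∘ (L *ᵥ ·) from rfl, this, ← List.map_append,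
    columnDet_map]
  simp; ring

/-! ### Blocks of consecutive columns and their reordering -/

/-- `[u a, u (a + 1), …, u (a + p - 1)]`. -/
def segment (u : ℤ → Fin K → ℂ) (a : ℤ) (p : ℕ) : List (Fin K → ℂ) :=
  (List.range p).map fun k : ℕ => u (a + (k : ℤ))

@[simp] theorem length_segment (u : ℤ → Fin K → ℂ) (a : ℤ) (p : ℕ) :
    (segment u a p).length = p := by simp [segment]

theorem segment_succ (u : ℤ → Fin K → ℂ) (a : ℤ) (p : ℕ) :
    segment u a (p + 1) = segment u a p ++ [u (a + p)] := by
  simp [segment, List.range_succ]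

theorem segment_succ' (u : ℤ → Fin K → ℂ) (a : ℤ) (p : ℕ) :
    segment u a (p + 1) = u a :: segment u (a + 1) p := by
  rw [segment, segment, List.range_succ_eq_map, List.map_cons, List.map_map, Nat.cast_zero,
    add_zero]
  congr 1
  refine List.map_congr_left fun k _ => ?_
  simp only [Function.comp, Nat.cast_succ]
  congr 1; ring

theorem map_segment (u w : ℤ → Fin K → ℂ) (T : (Fin K → ℂ) → Fin K → ℂ)
    (h : ∀ j, T (u j) = w (j + 1)) (a : ℤ) (p : ℕ) :
    (segment u a p).map T = segment w (a + 1) p := by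
  simp only [segment, List.map_map]
  refine List.map_congr_left fun k _ => ?_
  simp only [Function.comp, h]
  congr 1; ring


/-- This and the next four lemmas bring two exceptional columns from the ends of the blocks to the
place between P and Q where `columnDet_plucker` expects them. -/
theorem columnDet_cons_append_cons (P Q : List (Fin K → ℂ)) (x y : Fin K → ℂ)
    (h : P.length + Q.length + 2 = K) :
    columnDet (x :: (P ++ y :: Q)) = (-1) ^ P.length * columnDet (P ++ x :: y :: Q) :=
  columnDet_move [] P (y :: Q) x (by simp; omega)

theorem columnDet_append_cons_append_singleton (P Q : List (Fin K → ℂ)) (x y : Fin K → ℂ)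
    (h : P.length + Q.length + 2 = K) :
    columnDet (P ++ x :: (Q ++ [y])) = (-1) ^ Q.length * columnDet (P ++ x :: y :: Q) := by
  have := columnDet_move (P ++ [x]) Q [] y (by simp; omega)
  simp only [List.append_assoc, List.cons_append, List.nil_append, List.append_nil] at this
  rw [this, ← mul_assoc, ← pow_add, ← two_mul, pow_mul]
  simp

theorem columnDet_cons_append_append_singleton (P Q : List (Fin K → ℂ)) (x y : Fin K → ℂ)
    (h : P.length + Q.length + 2 = K) :
    columnDet (x :: (P ++ (Q ++ [y]))) =
      (-1) ^ P.length * (-1) ^ Q.length * columnDet (P ++ x :: y :: Q) := by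
  rw [mul_assoc, ← columnDet_append_cons_append_singleton P Q x y h]
  exact columnDet_move [] P (Q ++ [y]) x (by simp; omega)

theorem columnDet_cons_cons_append (P Q : List (Fin K → ℂ)) (x y : Fin K → ℂ)
    (h : P.length + Q.length + 2 = K) :
    columnDet (x :: y :: (P ++ Q)) = columnDet (P ++ x :: y :: Q) := by
  have h₁ := columnDet_move [x] P Q y (by simp; omega)
  have h₂ := columnDet_move [] P (y :: Q) x (by simp; omega)
  simp only [List.cons_append, List.nil_append] at h₁ h₂
  rw [h₁, h₂, ← mul_assoc, ← pow_add, ← two_mul, pow_mul]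
  simp

theorem columnDet_append_append_pair (P Q : List (Fin K → ℂ)) (x y : Fin K → ℂ)
    (h : P.length + Q.length + 2 = K) :
    columnDet (P ++ (Q ++ [x, y])) = columnDet (P ++ x :: y :: Q) := by
  have h₁ := columnDet_move P Q [y] x (by omega)
  have h₂ := columnDet_append_cons_append_singleton P Q x y h
  rw [h₂] at h₁
  rcases neg_one_pow_eq_or ℂ Q.length with e | e <;>
    (rw [e] at h₁; first | linear_combination -h₁ | linear_combination h₁)

theorem neg_one_pow_mul_self (n : ℕ) : (-1 : ℂ) ^ n * (-1) ^ n = 1 := by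
  rw [← pow_add, ← two_mul, pow_mul]; simp

/-! ### The six bilinear identities for double Wronskians -/

section identities

variable {n m : ℕ}

/-- Plücker with common block u₂,…,u_{n+1}; v₁,…,v_m and the extra columns u₀, u₁, v₀, v_{m+1}. It
underlies B₃; no relation between the columns is needed. -/
theorem bilinear_f_s_bottom (hK : n + m + 2 = K) (u v : ℤ → Fin K → ℂ) :
    columnDet (u 0 :: (segment u 2 n ++ segment v 0 (m + 1))) *
        columnDet (segment u 1 (n + 1) ++ segment v 1 (m + 1)) -
      columnDet (segment u 1 (n + 1) ++ segment v 0 (m + 1)) *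
        columnDet (u 0 :: (segment u 2 n ++ segment v 1 (m + 1))) =
    columnDet (segment u 0 (n + 2) ++ segment v 1 m) *
      columnDet (segment u 2 n ++ segment v 0 (m + 2)) := by
  have hl : (segment u 2 n).length + (segment v 1 m).length + 2 = K := by simpa using hK
  have hp := columnDet_plucker (segment u 2 n) (segment v 1 m) (u 0) (u 1)
    (v 0) (v (1 + m)) (by simp; omega)
  rw [segment_succ' u 0 (n + 1), zero_add, segment_succ' u 1 n, show (1 : ℤ) + 1 = 2 from rfl,
    segment_succ' v 0 (m + 1), segment_succ' v 0 m, zero_add, segment_succ v 1 m]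
  have e₁ := fun x y => columnDet_cons_append_cons _ _ x y hl
  have e₂ := fun x y => columnDet_cons_append_append_singleton _ _ x y hl
  have e₃ := fun x y => columnDet_append_cons_append_singleton _ _ x y hl
  have e₄ := fun x y => columnDet_cons_cons_append _ _ x y hl
  simp only [List.cons_append]
  simp only [e₁, e₂, e₃, e₄, length_segment]
  have e := neg_one_pow_mul_self n
  -- Two of the three products carry the sign twice and the third not at all; `e`, which becomes ε²
  -- = 1, reconciles them.
  generalize (-1 : ℂ) ^ n = ε at *
  linear_combination (-(-1) ^ m * ε * ε) * hp + (-1) ^ m *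
    columnDet (segment u 2 n ++ u 0 :: u 1 :: segment v 1 m) *
    columnDet (segment u 2 n ++ v 0 :: v (1 + m) :: segment v 1 m) * e

/-- Plücker for u₁, v₀, v_{m+1}, v_{m+2} over the block u₂,…,u_{n+1}; v₁,…,v_m; used for B₅. -/
theorem bilinear_h_s_top (hK : n + m + 2 = K) (u v : ℤ → Fin K → ℂ) :
    columnDet (segment u 2 n ++ (segment v 0 (m + 1) ++ [v (m + 1 + 1)])) *
        columnDet (segment u 1 (n + 1) ++ segment v 1 (m + 1)) -
      columnDet (segment u 2 n ++ segment v 0 (m + 2)) *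
        columnDet (segment u 1 (n + 1) ++ (segment v 1 m ++ [v (1 + m + 1)])) =
    columnDet (segment u 2 n ++ segment v 1 (m + 2)) *
      columnDet (segment u 1 (n + 1) ++ segment v 0 (m + 1)) := by
  have hl : (segment u 2 n).length + (segment v 1 m).length + 2 = K := by simpa using hK
  have hp := columnDet_plucker (segment u 2 n) (segment v 1 m) (u 1) (v 0)
    (v (1 + m)) (v (1 + m + 1)) (by simp; omega)
  have e₁ := fun x y => columnDet_cons_append_cons _ _ x y hl
  have e₂ := fun x y => columnDet_cons_append_append_singleton _ _ x y hl
  have e₃ := fun x y => columnDet_append_cons_append_singleton _ _ x y hl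
  have e₄ := fun x y => columnDet_append_append_pair _ _ x y hl
  rw [segment_succ' u 1 n, show (1 : ℤ) + 1 = 2 from rfl,
    segment_succ' v 0 (m + 1), segment_succ' v 0 m, zero_add, segment_succ v 1 (m + 1),
    segment_succ v 1 m, show (m : ℤ) + 1 + 1 = 1 + m + 1 by ring]
  simp only [List.append_assoc, List.cons_append, List.nil_append, Nat.cast_succ, ← add_assoc]
  simp only [e₁, e₂, e₃, e₄, length_segment]
  have e := neg_one_pow_mul_self m
  generalize (-1 : ℂ) ^ m = ε at *
  linear_combination (-(-1) ^ n * ε * ε) * hp + (-1) ^ n *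
    columnDet (segment u 2 n ++ u 1 :: v 0 :: segment v 1 m) *
    columnDet (segment u 2 n ++ v (1 + m) :: v (1 + m + 1) :: segment v 1 m) * e

variable (L : Matrix (Fin K) (Fin K) ℂ) (u v : ℤ → Fin K → ℂ)
  (hu : ∀ j, L *ᵥ u j = u (j + 1)) (hv : ∀ j, L *ᵥ v j = -v (j + 1))

include hu hv

/-- Raising all indices by one is multiplication by `L`, up to one sign per v-column. This moves
determinants with different ranges onto a common block. -/
theorem columnDet_segment_shift (a b : ℤ) (p q : ℕ) (h : p + q ≤ K) :
    columnDet (segment u (a + 1) p ++ segment v (b + 1) q) =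
      L.det * (-1) ^ q * columnDet (segment u a p ++ segment v b q) := by
  have := columnDet_map_append_map_neg L (segment u a p) (segment v b q) (by simpa using h)
  rw [map_segment u u _ hu, map_segment v v _ (fun j => by rw [hv, neg_neg])] at this
  simpa using this

variable (hK : n + m + 2 = K)

include hK

/-- Used for B₆. On the right one factor is shifted up and the other down, so det L cancels without
division. -/
theorem bilinear_f_s_top :
    columnDet (segment u 1 n ++ u (1 + n + 1) :: segment v 0 (m + 1)) *
        columnDet (segment u 1 (n + 1) ++ segment v 1 (m + 1)) -
      columnDet (segment u 1 (n + 1) ++ segment v 0 (m + 1)) *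
        columnDet (segment u 1 n ++ u (1 + n + 1) :: segment v 1 (m + 1)) =
    -(columnDet (segment u 0 (n + 2) ++ segment v 0 m) *
        columnDet (segment u 2 n ++ segment v 1 (m + 2))) := by
  have hl : (segment u 1 n).length + (segment v 1 m).length + 2 = K := by simpa using hK
  have hp := columnDet_plucker (segment u 1 n) (segment v 1 m) (u (1 + n)) (u (1 + n + 1))
    (v 0) (v (1 + m)) (by simp; omega)
  have h₁ := columnDet_segment_shift L u v hu hv 0 0 (n + 2) m (by omega)
  have h₂ := columnDet_segment_shift L u v hu hv 1 0 n (m + 2) (by omega)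
  rw [zero_add, segment_succ u 1 (n + 1), segment_succ u 1 n] at h₁
  rw [zero_add, segment_succ' v 0 (m + 1), zero_add, segment_succ v 1 m,
    show (1 : ℤ) + 1 = 2 from rfl] at h₂
  rw [segment_succ u 1 n, segment_succ' v 0 m, zero_add, segment_succ v 1 m]
  have e₁ := fun x y => columnDet_append_cons_append_singleton _ _ x y hl
  simp only [List.append_assoc, List.cons_append, List.nil_append, Nat.cast_succ, ← add_assoc]
    at h₁ h₂ ⊢
  rw [h₂]
  simp only [e₁, length_segment]
  linear_combination (-1) ^ m * hp -
    (-1) ^ m * columnDet (segment u 1 n ++ v 0 :: v (1 + m) :: segment v 1 m) * h₁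

/-- Used for B₄, with extra columns u₀, u_{n+1}, u_{n+2}, v₀. As in `bilinear_f_s_top`, the two
shifts on the right compensate each other. -/
theorem bilinear_g_f_top :
    columnDet (segment u 0 (n + 1) ++ u (n + 1 + 1) :: segment v 1 m) *
        columnDet (segment u 1 (n + 1) ++ segment v 0 (m + 1)) -
      columnDet (segment u 0 (n + 2) ++ segment v 1 m) *
        columnDet (segment u 1 n ++ u (1 + n + 1) :: segment v 0 (m + 1)) =
    -(columnDet (segment u 0 (n + 2) ++ segment v 0 m) *
        columnDet (segment u 1 (n + 1) ++ segment v 1 (m + 1))) := by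
  have hl : (segment u 1 n).length + (segment v 1 m).length + 2 = K := by simpa using hK
  have hp := columnDet_plucker (segment u 1 n) (segment v 1 m) (u 0) (u (1 + n + 1))
    (u (1 + n)) (v 0) (by simp; omega)
  have h₁ := columnDet_segment_shift L u v hu hv 0 0 (n + 2) m (by omega)
  have h₂ := columnDet_segment_shift L u v hu hv 0 0 (n + 1) (m + 1) (by omega)
  have e₁ := fun x y => columnDet_cons_append_cons _ _ x y hl
  have e₂ := columnDet_swap (segment u 1 n) (segment v 1 m) (u (1 + n)) (u (1 + n + 1))
    (by simp; omega)
  rw [zero_add, segment_succ u 1 (n + 1), segment_succ' u 0 (n + 1), zero_add,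
    segment_succ u 1 n] at h₁
  rw [zero_add, segment_succ' u 0 n, segment_succ' v 0 m, zero_add] at h₂
  rw [h₂, segment_succ u 1 n, segment_succ' u 0 (n + 1), zero_add, segment_succ' u 0 n,
    zero_add, segment_succ u 1 n, segment_succ' v 0 m, zero_add,
    show (n : ℤ) + 1 + 1 = 1 + n + 1 by ring]
  simp only [List.append_assoc, List.cons_append, List.nil_append, Nat.cast_succ, ← add_assoc]
    at h₁ h₂ ⊢
  simp only [e₁, length_segment]
  linear_combination (-1) ^ n * hp + (-1) ^ n *
    columnDet (segment u 1 n ++ u 0 :: v 0 :: segment v 1 m) * (h₁ - e₂)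

/-- Used for B₁. In each of the three products one factor is shifted down, so the identity is det L
times a Plücker relation. The column u₋₁ is the reason for indexing by ℤ. -/
theorem bilinear_ht_s_bottom :
    columnDet (u (-1) :: (segment u 1 (n + 1) ++ segment v 0 m)) *
        columnDet (segment u 1 (n + 1) ++ segment v 1 (m + 1)) -
      columnDet (segment u 0 (n + 2) ++ segment v 0 m) *
        columnDet (u 0 :: (segment u 2 n ++ segment v 1 (m + 1))) =
    -(columnDet (segment u 0 (n + 2) ++ segment v 1 m) *
      columnDet (segment u 1 (n + 1) ++ segment v 0 (m + 1))) := by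
  have hl : (segment u 1 n).length + (segment v 0 m).length + 2 = K := by simpa using hK
  have hp := columnDet_plucker (segment u 1 n) (segment v 0 m) (u (-1)) (u 0)
    (u (1 + n)) (v (0 + m)) (by simp; omega)
  have h₁ := columnDet_segment_shift L u v hu hv 0 0 (n + 1) (m + 1) (by omega)
  have h₂ := columnDet_segment_shift L u v hu hv (-1) 0 (n + 2) m (by omega)
  have h₃ := columnDet_map_append_map_neg L (u (-1) :: segment u 1 n) (segment v 0 (m + 1))
    (by simp; omega)
  rw [List.map_cons, map_segment u u _ hu, map_segment v v _ (fun j => by rw [hv, neg_neg]),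
    hu, length_segment, neg_add_cancel, zero_add, show (1 : ℤ) + 1 = 2 from rfl, List.cons_append,
    List.cons_append] at h₃
  have e₁ := fun x y => columnDet_cons_append_cons _ _ x y hl
  have e₂ := fun x y => columnDet_cons_append_append_singleton _ _ x y hl
  have e₃ := fun x y => columnDet_append_cons_append_singleton _ _ x y hl
  have e₄ := fun x y => columnDet_cons_cons_append _ _ x y hl
  rw [zero_add] at h₁
  rw [neg_add_cancel, zero_add] at h₂
  rw [h₁, h₂, h₃]
  rw [segment_succ' u (-1) (n + 1), neg_add_cancel, segment_succ' u 0 (n + 1), zero_add,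
    segment_succ' u 0 n, zero_add, segment_succ u 1 n, segment_succ v 0 m]
  simp only [List.append_assoc, List.cons_append, List.nil_append]
  simp only [e₁, e₂, e₃, e₄, length_segment]
  have e := neg_one_pow_mul_self n
  generalize (-1 : ℂ) ^ n = ε at *
  linear_combination (L.det * ((-1) ^ m) ^ 2 * ε * ε) * hp - L.det * ((-1) ^ m) ^ 2 *
    columnDet (segment u 1 n ++ u (-1) :: u 0 :: segment v 0 m) *
    columnDet (segment u 1 n ++ u (1 + n) :: v (0 + m) :: segment v 0 m) * e

/-- Used for B₂. Here one factor of each product is shifted up, to the block u₂,…,u_{n+1};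
v₂,…,v_{m+1}, so a common det L has to be cancelled. -/
theorem bilinear_hb_f_bottom (hL : L.det ≠ 0) :
    columnDet (segment u 2 n ++ v 0 :: segment v 2 (m + 1)) *
        columnDet (segment u 1 (n + 1) ++ segment v 0 (m + 1)) -
      columnDet (segment u 2 n ++ segment v 1 (m + 2)) *
        columnDet (segment u 1 (n + 1) ++ v (-1) :: segment v 1 m) =
    columnDet (segment u 2 n ++ segment v 0 (m + 2)) *
      columnDet (segment u 1 (n + 1) ++ segment v 1 (m + 1)) := by
  have hl : (segment u 2 n).length + (segment v 2 m).length + 2 = K := by simpa using hK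
  have hp := columnDet_plucker (segment u 2 n) (segment v 2 m) (u (2 + n)) (v 0)
    (v 1) (v (2 + m)) (by simp; omega)
  have h₁ := columnDet_segment_shift L u v hu hv 1 0 (n + 1) (m + 1) (by omega)
  have h₂ := columnDet_segment_shift L u v hu hv 1 1 (n + 1) (m + 1) (by omega)
  have h₃ := columnDet_map_append_map_neg L (segment u 1 (n + 1)) (v (-1) :: segment v 1 m)
    (by simp; omega)
  rw [List.map_cons, map_segment u u _ hu, map_segment v v _ (fun j => by rw [hv, neg_neg]),
    hv, neg_neg, neg_add_cancel, show (1 : ℤ) + 1 = 2 from rfl, List.length_cons,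
    length_segment, segment_succ u 2 n] at h₃
  rw [zero_add, show (1 : ℤ) + 1 = 2 from rfl, segment_succ' v 1 m, segment_succ u 2 n,
    show (1 : ℤ) + 1 = 2 from rfl] at h₁
  rw [show (1 : ℤ) + 1 = 2 from rfl, segment_succ u 2 n, segment_succ v 2 m, segment_succ' v 1 m,
    show (1 : ℤ) + 1 = 2 from rfl] at h₂
  have e₃ := fun x y => columnDet_append_cons_append_singleton _ _ x y hl
  rw [segment_succ' v 1 (m + 1), segment_succ' v 0 (m + 1), zero_add, segment_succ' v 1 m,
    show (1 : ℤ) + 1 = 2 from rfl, segment_succ v 2 m]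
  simp only [List.append_assoc, List.cons_append, List.nil_append] at h₁ h₂ h₃ ⊢
  simp only [e₃, length_segment] at h₁ h₂ h₃ ⊢
  refine mul_left_cancel₀ (mul_ne_zero hL (pow_ne_zero (m + 1) (neg_ne_zero.2 one_ne_zero))) ?_
  linear_combination (-(-1) ^ m) * hp -
    (-1) ^ m * columnDet (segment u 2 n ++ v 0 :: v (2 + m) :: segment v 2 m) * h₁ +
    (-1) ^ m * columnDet (segment u 2 n ++ v 1 :: v (2 + m) :: segment v 2 m) * h₃ +
    columnDet (segment u 2 n ++ v 0 :: v 1 :: segment v 2 m) * h₂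

end identities

/-! ### Derivatives of double Wronskians -/

theorem hasDerivAt_det {M : ℝ → Matrix (Fin K) (Fin K) ℂ} {M' : Matrix (Fin K) (Fin K) ℂ} {y : ℝ}
    (h : ∀ i j, HasDerivAt (fun y => M y i j) (M' i j) y) :
    HasDerivAt (fun y => (M y).det) (∑ j, ((M y).updateCol j fun i => M' i j).det) y := by
  simp only [Matrix.det_apply]
  rw [Finset.sum_comm]
  refine HasDerivAt.fun_sum fun σ _ => ?_
  rw [← Finset.smul_sum]
  refine HasDerivAt.const_smul _ ?_
  refine (HasDerivAt.fun_finsetProd fun i _ => h (σ i) i).congr_deriv ?_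
  refine Finset.sum_congr rfl fun j _ => ?_
  rw [← Finset.prod_erase_mul _ _ (Finset.mem_univ j), smul_eq_mul, Matrix.updateCol_self]
  congr 1
  refine Finset.prod_congr rfl fun i hi => ?_
  rw [Matrix.updateCol_ne (Finset.ne_of_mem_erase hi)]

/-- By Cramer the summands are the diagonal entries of adj(M)·T·M, and the trace is cyclic. -/
theorem sum_det_updateCol_mulVec (M T : Matrix (Fin K) (Fin K) ℂ) :
    ∑ j, (M.updateCol j (T *ᵥ fun i => M i j)).det = T.trace * M.det := by
  have : ∀ j, (M.updateCol j (T *ᵥ fun i => M i j)).det = (M.adjugate * (T * M)) j j := by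
    intro j
    rw [← Matrix.cramer_apply, Matrix.cramer_eq_adjugate_mulVec, Matrix.mul_apply]
    rfl
  rw [Finset.sum_congr rfl fun j _ => this j]
  change (M.adjugate * (T * M)).trace = _
  rw [Matrix.trace_mul_comm, Matrix.mul_assoc, Matrix.mul_adjugate, Matrix.mul_smul,
    Matrix.mul_one, Matrix.trace_smul, smul_eq_mul, mul_comm]

/-- Split each weight as ε = σ + (ε - σ). The constant part sums to a trace term; in the rest a
column contributes nothing if ε = σ or if T makes it proportional to another column, which leaves
only the column `w`. -/
theorem hasDerivAt_columnDet {l : ℝ → List (Fin K → ℂ)} {T : Matrix (Fin K) (Fin K) ℂ}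
    {ε : ℕ → ℂ} {y : ℝ} {σ : ℂ} {l₁ l₂ : List (Fin K → ℂ)} {w : Fin K → ℂ}
    (hl : ∀ j < K, HasDerivAt (fun y => (l y).getD j 0) (ε j • (T *ᵥ (l y).getD j 0)) y)
    (h₁ : l₁.length < K) (hw : l y = l₁ ++ w :: l₂)
    (h : ∀ j < K, j ≠ l₁.length → ε j = σ ∨
      ∃ k < K, k ≠ j ∧ ∃ r : ℂ, T *ᵥ (l y).getD j 0 = r • (l y).getD k 0) :
    HasDerivAt (fun y => columnDet (l y))
      (σ * T.trace * columnDet (l y) +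
        (ε l₁.length - σ) * columnDet (l₁ ++ (T *ᵥ w) :: l₂)) y := by
  set M : ℝ → Matrix (Fin K) (Fin K) ℂ := fun y => Matrix.of fun i j : Fin K => (l y).getD j 0 i
  set D : Fin K → ℂ := fun j => ((M y).updateCol j (T *ᵥ fun i => M y i j)).det with hD
  have hder := hasDerivAt_det (M := M) (y := y)
    (M' := Matrix.of fun i j : Fin K => (ε j • (T *ᵥ (l y).getD j 0)) i)
    (fun i j => (hasDerivAt_pi.1 (hl j j.2)) i)
  refine hder.congr_deriv ?_
  have hterm : ∀ j : Fin K, ((M y).updateCol j fun i =>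
      (Matrix.of fun i j : Fin K => (ε j • (T *ᵥ (l y).getD j 0)) i) i j).det = ε j * D j := by
    intro j
    exact Matrix.det_updateCol_smul (M y) j (ε j) _
  have hzero : ∀ j : Fin K, j ≠ ⟨l₁.length, h₁⟩ → (ε j - σ) * D j = 0 := by
    intro j hj
    rcases h j j.2 (fun e => hj (Fin.ext e)) with e | ⟨k, hk, hkj, r, e⟩
    · rw [e, sub_self, zero_mul]
    · have : (T *ᵥ fun i => M y i j) = r • fun i => M y i ⟨k, hk⟩ := e
      have hkj' : (⟨k, hk⟩ : Fin K) ≠ j := fun e => hkj (congrArg Fin.val e)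
      rw [hD]
      simp only [this]
      rw [Matrix.det_updateCol_smul, Matrix.det_zero_of_column_eq hkj', mul_zero, mul_zero]
      intro i
      rw [Matrix.updateCol_self, Matrix.updateCol_ne hkj']
  have hj₀ : D ⟨l₁.length, h₁⟩ = columnDet (l₁ ++ (T *ᵥ w) :: l₂) := by
    rw [columnDet_append_cons_eq_cramer l₁ l₂ w _ h₁, Matrix.cramer_apply, ← hw]
    have : (fun i => M y i ⟨l₁.length, h₁⟩) = w := by
      change (l y).getD l₁.length 0 = w
      rw [hw]; simp
    rw [hD]
    simp only [this]
    rfl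
  rw [Finset.sum_congr rfl fun j _ => hterm j]
  have hsplit : ∀ j : Fin K, ε j * D j = σ * D j + (ε j - σ) * D j := fun j => by ring
  rw [Finset.sum_congr rfl fun j _ => hsplit j, Finset.sum_add_distrib, ← Finset.mul_sum,
    Finset.sum_eq_single_of_mem _ (Finset.mem_univ ⟨l₁.length, h₁⟩) (fun j _ hj => hzero j hj),
    sum_det_updateCol_mulVec, hj₀, mul_assoc]
  rfl

theorem getD_segment_append_segment (u v : ℤ → Fin K → ℂ) (a b : ℤ) (p q j : ℕ) (h : j < p + q) :
    (segment u a p ++ segment v b q).getD j 0 =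
      if j < p then u (a + j) else v (b + (j - p : ℕ)) := by
  split_ifs with hj
  · rw [List.getD_append _ _ _ _ (by simpa using hj)]
    simp [segment, hj]
  · rw [List.getD_append_right _ _ _ _ (by simpa using hj)]
    simp [segment, show j - p < q by omega]

section derivative

variable {T : Matrix (Fin K) (Fin K) ℂ} {u v : ℝ → ℤ → Fin K → ℂ} {y : ℝ} {r : ℂ}
  (hu : ∀ j, HasDerivAt (fun y => u y j) (T *ᵥ u y j) y)
  (hv : ∀ j, HasDerivAt (fun y => v y j) (-(T *ᵥ v y j)) y)

include hu hv

theorem hasDerivAt_getD_segment (a b : ℤ) (p q j : ℕ) (h : j < p + q) :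
    HasDerivAt (fun y => (segment (u y) a p ++ segment (v y) b q).getD j 0)
      ((if j < p then (1 : ℂ) else -1) •
        (T *ᵥ (segment (u y) a p ++ segment (v y) b q).getD j 0)) y := by
  simp only [getD_segment_append_segment _ _ a b p q j h]
  split_ifs with hj
  · rw [one_smul]; exact hu _
  · rw [neg_one_smul]; exact hv _

/-- In the `left` versions σ = -1 removes the v-block; in the `right` versions σ = 1 removes the
u-block. `top` and `bottom` tell whether T raises or lowers indices, hence which end column moves.
Having both sides available lets the two factors of a Hirota derivative carry the same trace
coefficient. -/
theorem hasDerivAt_columnDet_top_left (hTu : ∀ j, T *ᵥ u y j = r • u y (j + 1))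
    (a b : ℤ) (p q : ℕ) (hK : p + 1 + q = K) :
    HasDerivAt (fun y => columnDet (segment (u y) a (p + 1) ++ segment (v y) b q))
      (-T.trace * columnDet (segment (u y) a (p + 1) ++ segment (v y) b q) +
        2 * r * columnDet (segment (u y) a p ++ u y (a + p + 1) :: segment (v y) b q)) y := by
  have := hasDerivAt_columnDet (l := fun y => segment (u y) a (p + 1) ++ segment (v y) b q)
    (T := T) (ε := fun j => if j < p + 1 then (1 : ℂ) else -1) (y := y) (σ := -1)
    (l₁ := segment (u y) a p) (w := u y (a + p)) (l₂ := segment (v y) b q)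
    (fun j hj => hasDerivAt_getD_segment hu hv a b (p + 1) q j (by omega)) (by simp; omega)
    (by rw [segment_succ]; simp) (fun j hj hne => by
      rw [length_segment] at hne
      by_cases h : j < p + 1
      · refine .inr ⟨j + 1, by omega, by omega, r, ?_⟩
        rw [getD_segment_append_segment _ _ _ _ _ _ _ (by omega),
          getD_segment_append_segment _ _ _ _ _ _ _ (by omega), if_pos h, if_pos (by omega), hTu,
          Nat.cast_succ, add_assoc]
      · exact .inl (if_neg h))
  refine this.congr_deriv ?_
  rw [hTu, columnDet_smul _ _ _ _ (by simp; omega), length_segment, if_pos (Nat.lt_succ_self p)]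
  ring

theorem hasDerivAt_columnDet_bottom_left (hTu : ∀ j, T *ᵥ u y j = r • u y (j - 1))
    (a b : ℤ) (p q : ℕ) (hK : p + 1 + q = K) :
    HasDerivAt (fun y => columnDet (segment (u y) a (p + 1) ++ segment (v y) b q))
      (-T.trace * columnDet (segment (u y) a (p + 1) ++ segment (v y) b q) +
        2 * r * columnDet (u y (a - 1) :: (segment (u y) (a + 1) p ++ segment (v y) b q))) y := by
  have := hasDerivAt_columnDet (l := fun y => segment (u y) a (p + 1) ++ segment (v y) b q)
    (T := T) (ε := fun j => if j < p + 1 then (1 : ℂ) else -1) (y := y) (σ := -1)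
    (l₁ := []) (w := u y a) (l₂ := segment (u y) (a + 1) p ++ segment (v y) b q)
    (fun j hj => hasDerivAt_getD_segment hu hv a b (p + 1) q j (by omega)) (by simp; omega)
    (by rw [segment_succ']; simp) (fun j hj hne => by
      rw [List.length_nil] at hne
      by_cases h : j < p + 1
      · refine .inr ⟨j - 1, by omega, by omega, r, ?_⟩
        rw [getD_segment_append_segment _ _ _ _ _ _ _ (by omega),
          getD_segment_append_segment _ _ _ _ _ _ _ (by omega), if_pos h, if_pos (by omega), hTu,
          Nat.cast_pred (by omega), add_sub_assoc]
      · exact .inl (if_neg h))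
  refine this.congr_deriv ?_
  rw [hTu, columnDet_smul _ _ _ _ (by simp; omega), List.length_nil, if_pos (Nat.succ_pos p)]
  simp only [List.nil_append]
  ring

theorem hasDerivAt_columnDet_top_right (hTv : ∀ j, T *ᵥ v y j = -r • v y (j + 1))
    (a b : ℤ) (p q : ℕ) (hK : p + (q + 1) = K) :
    HasDerivAt (fun y => columnDet (segment (u y) a p ++ segment (v y) b (q + 1)))
      (T.trace * columnDet (segment (u y) a p ++ segment (v y) b (q + 1)) +
        2 * r * columnDet (segment (u y) a p ++ (segment (v y) b q ++ [v y (b + q + 1)]))) y := by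
  have := hasDerivAt_columnDet (l := fun y => segment (u y) a p ++ segment (v y) b (q + 1))
    (T := T) (ε := fun j => if j < p then (1 : ℂ) else -1) (y := y) (σ := 1)
    (l₁ := segment (u y) a p ++ segment (v y) b q) (w := v y (b + q)) (l₂ := [])
    (fun j hj => hasDerivAt_getD_segment hu hv a b p (q + 1) j (by omega)) (by simp; omega)
    (by rw [segment_succ]; simp) (fun j hj hne => by
      rw [List.length_append, length_segment, length_segment] at hne
      by_cases h : j < p
      · exact .inl (if_pos h)
      · refine .inr ⟨j + 1, by omega, by omega, -r, ?_⟩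
        rw [getD_segment_append_segment _ _ _ _ _ _ _ (by omega),
          getD_segment_append_segment _ _ _ _ _ _ _ (by omega), if_neg h, if_neg (by omega), hTv,
          Nat.succ_sub (by omega), Nat.cast_succ, add_assoc])
  refine this.congr_deriv ?_
  rw [hTv, columnDet_smul _ _ _ _ (by simp; omega), List.length_append, length_segment,
    length_segment, if_neg (by omega), List.append_assoc]
  ring

theorem hasDerivAt_columnDet_bottom_right (hTv : ∀ j, T *ᵥ v y j = -r • v y (j - 1))
    (a b : ℤ) (p q : ℕ) (hK : p + (q + 1) = K) :
    HasDerivAt (fun y => columnDet (segment (u y) a p ++ segment (v y) b (q + 1)))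
      (T.trace * columnDet (segment (u y) a p ++ segment (v y) b (q + 1)) +
        2 * r * columnDet (segment (u y) a p ++ v y (b - 1) :: segment (v y) (b + 1) q)) y := by
  have := hasDerivAt_columnDet (l := fun y => segment (u y) a p ++ segment (v y) b (q + 1))
    (T := T) (ε := fun j => if j < p then (1 : ℂ) else -1) (y := y) (σ := 1)
    (l₁ := segment (u y) a p) (w := v y b) (l₂ := segment (v y) (b + 1) q)
    (fun j hj => hasDerivAt_getD_segment hu hv a b p (q + 1) j (by omega)) (by simp; omega)
    (by rw [segment_succ']) (fun j hj hne => by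
      rw [length_segment] at hne
      by_cases h : j < p
      · exact .inl (if_pos h)
      · refine .inr ⟨j - 1, by omega, by omega, -r, ?_⟩
        rw [getD_segment_append_segment _ _ _ _ _ _ _ (by omega),
          getD_segment_append_segment _ _ _ _ _ _ _ (by omega), if_neg h, if_neg (by omega), hTv,
          Nat.sub_right_comm, Nat.cast_pred (by omega), add_sub_assoc])
  refine this.congr_deriv ?_
  rw [hTv, columnDet_smul _ _ _ _ (by simp; omega), length_segment, if_neg (by omega)]
  ring

end derivative


/-! ### Hirota derivatives and passage to the massive Thirring model -/

theorem hirotaD_zero_one (u v : ℝ → ℝ → ℂ) (x t : ℝ) :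
    hirotaD 0 1 u v x t = dt u x t * v x t - u x t * dt v x t := by
  simp [hirotaD, hirotaT, dt]

theorem hirotaD_one_zero (u v : ℝ → ℝ → ℂ) (x t : ℝ) :
    hirotaD 1 0 u v x t = dx u x t * v x t - u x t * dx v x t := by
  simp [hirotaD, hirotaX, dx]

section partial_derivatives

variable {E : Type*} [NormedAddCommGroup E] [NormedSpace ℝ E] {u : ℝ → ℝ → E}

theorem hasDerivAt_prodMk_left (x t : ℝ) :
    HasDerivAt (fun y : ℝ => (y, t)) ((1, 0) : ℝ × ℝ) x :=
  (hasDerivAt_id x).prodMk (hasDerivAt_const x t)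

theorem hasDerivAt_prodMk_right (x t : ℝ) :
    HasDerivAt (fun τ : ℝ => (x, τ)) ((0, 1) : ℝ × ℝ) t :=
  (hasDerivAt_const t x).prodMk (hasDerivAt_id t)

/-- Mixed partial derivatives of a smooth function agree. -/
theorem Smooth.mixed_partials (h : Smooth u) {ux ut : ℝ → ℝ → E} {uxt utx : E} {x t : ℝ}
    (hx : ∀ x t, HasDerivAt (fun y => u y t) (ux x t) x)
    (ht : ∀ x t, HasDerivAt (fun τ => u x τ) (ut x t) t)
    (hxt : HasDerivAt (fun τ => ux x τ) uxt t) (htx : HasDerivAt (fun y => ut y t) utx x) :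
    uxt = utx := by
  obtain ⟨F, hFu, hF⟩ : ∃ F : ℝ × ℝ → E, (∀ x t, u x t = F (x, t)) ∧ ContDiff ℝ ∞ F :=
    ⟨_, fun _ _ => rfl, h⟩
  simp only [hFu] at hx ht
  have hd : ∀ p, HasFDerivAt F (fderiv ℝ F p) p := fun p =>
    (hF.differentiable (by simp) p).hasFDerivAt
  have hd2 : HasFDerivAt (fderiv ℝ F) (fderiv ℝ (fderiv ℝ F) (x, t)) (x, t) :=
    ((hF.fderiv_right (m := ∞) (by simp)).differentiable (by simp) (x, t)).hasFDerivAt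
  have e₁ : ∀ x t, fderiv ℝ F (x, t) (1, 0) = ux x t := fun x t =>
    ((hd (x, t)).comp_hasDerivAt x (hasDerivAt_prodMk_left x t)).unique (hx x t)
  have e₂ : ∀ x t, fderiv ℝ F (x, t) (0, 1) = ut x t := fun x t =>
    ((hd (x, t)).comp_hasDerivAt t (hasDerivAt_prodMk_right x t)).unique (ht x t)
  have d₁ : HasDerivAt (fun τ => fderiv ℝ F (x, τ) (1, 0))
      (fderiv ℝ (fderiv ℝ F) (x, t) (0, 1) (1, 0)) t :=
    (ContinuousLinearMap.apply ℝ E ((1, 0) : ℝ × ℝ)).hasFDerivAt.comp_hasDerivAt t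
      (hd2.comp_hasDerivAt t (hasDerivAt_prodMk_right x t))
  have d₂ : HasDerivAt (fun y => fderiv ℝ F (y, t) (0, 1))
      (fderiv ℝ (fderiv ℝ F) (x, t) (1, 0) (0, 1)) x :=
    (ContinuousLinearMap.apply ℝ E ((0, 1) : ℝ × ℝ)).hasFDerivAt.comp_hasDerivAt x
      (hd2.comp_hasDerivAt x (hasDerivAt_prodMk_left x t))
  simp only [e₁] at d₁
  simp only [e₂] at d₂
  rw [hxt.unique d₁, htx.unique d₂]
  exact second_derivative_symmetric hd hd2 _ _

theorem Smooth.hasDerivAt_dx {u : ℝ → ℝ → ℂ} (h : Smooth u) (x t : ℝ) :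
    HasDerivAt (fun y => u y t) (dx u x t) x :=
  DifferentiableAt.hasDerivAt (f := fun y => u y t)
    (DifferentiableAt.comp (g := fun p : ℝ × ℝ => u p.1 p.2) x
      ((ContDiff.differentiable h (by simp)) (x, t))
      (hasDerivAt_prodMk_left x t).differentiableAt)

theorem Smooth.hasDerivAt_dt {u : ℝ → ℝ → ℂ} (h : Smooth u) (x t : ℝ) :
    HasDerivAt (fun τ => u x τ) (dt u x t) t :=
  DifferentiableAt.hasDerivAt (f := fun τ => u x τ)
    (DifferentiableAt.comp (g := fun p : ℝ × ℝ => u p.1 p.2) t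
      ((ContDiff.differentiable h (by simp)) (x, t))
      (hasDerivAt_prodMk_right x t).differentiableAt)

end partial_derivatives

theorem dx_div {u v : ℝ → ℝ → ℂ} (hu : Smooth u) (hv : Smooth v) (c : ℂ) {x t : ℝ}
    (h : v x t ≠ 0) :
    dx (fun x t => c * (u x t / v x t)) x t =
      c * ((dx u x t * v x t - u x t * dx v x t) / v x t ^ 2) :=
  (((hu.hasDerivAt_dx x t).fun_div (hv.hasDerivAt_dx x t) h).const_mul c).deriv

theorem dt_div {u v : ℝ → ℝ → ℂ} (hu : Smooth u) (hv : Smooth v) {x t : ℝ} (h : v x t ≠ 0) :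
    dt (fun x t => u x t / v x t) x t =
      (dt u x t * v x t - u x t * dt v x t) / v x t ^ 2 :=
  ((hu.hasDerivAt_dt x t).fun_div (hv.hasDerivAt_dt x t) h).deriv

/-- Solutions of the bilinear equations yield solutions of the massive Thirring model. -/
theorem IsBilinearSolution.isMTMSolutionOn {f g h s ht hb : ℝ → ℝ → ℂ}
    (H : IsBilinearSolution f g h s ht hb) :
    IsMTMSolutionOn {p | f p.1 p.2 ≠ 0 ∧ s p.1 p.2 ≠ 0}
      (fun x t => ht x t / f x t) (fun x t => hb x t / s x t)
      (fun x t => Complex.I * (g x t / s x t)) (fun x t => -Complex.I * (h x t / f x t)) := by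
  have hf : ContDiff ℝ ∞ fun p : ℝ × ℝ => f p.1 p.2 := H.smooth_f
  have hg : ContDiff ℝ ∞ fun p : ℝ × ℝ => g p.1 p.2 := H.smooth_g
  have hh : ContDiff ℝ ∞ fun p : ℝ × ℝ => h p.1 p.2 := H.smooth_h
  have hs : ContDiff ℝ ∞ fun p : ℝ × ℝ => s p.1 p.2 := H.smooth_s
  have hht : ContDiff ℝ ∞ fun p : ℝ × ℝ => ht p.1 p.2 := H.smooth_ht
  have hhb : ContDiff ℝ ∞ fun p : ℝ × ℝ => hb p.1 p.2 := H.smooth_hb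
  have I2 := Complex.I_sq
  have hdiv : ∀ {u v : ℝ × ℝ → ℂ}, ContDiff ℝ ∞ u → ContDiff ℝ ∞ v →
      (∀ p ∈ {p : ℝ × ℝ | f p.1 p.2 ≠ 0 ∧ s p.1 p.2 ≠ 0}, v p ≠ 0) →
      ContDiffOn ℝ ∞ (fun p => u p / v p) {p | f p.1 p.2 ≠ 0 ∧ s p.1 p.2 ≠ 0} := by
    intro u v hu hv h0
    simp only [div_eq_mul_inv]
    exact hu.contDiffOn.mul (hv.contDiffOn.inv h0)
  refine ⟨?_, ?_, ?_, ?_, ?_, ?_, ?_, ?_, ?_⟩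
  · exact (isOpen_ne.preimage hf.continuous).inter (isOpen_ne.preimage hs.continuous)
  · exact hdiv hht hf fun p hp => hp.1
  · exact hdiv hhb hs fun p hp => hp.2
  · exact contDiffOn_const.mul (hdiv hg hs fun p hp => hp.2)
  · exact contDiffOn_const.mul (hdiv hh hf fun p hp => hp.1)
  · rintro x t ⟨h₁, h₂⟩
    simp only at h₁ h₂
    have b₁ := H.B1 x t
    have b₃ := H.B3 x t
    rw [hirotaD_zero_one] at b₁ b₃
    rw [dt_div H.smooth_ht H.smooth_f h₁]
    field_simp
    -- No bilinear equation contains D_t h̃·f; it comes from s D(h̃·f) = f D(h̃·s) - h̃ D(f·s). The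
    -- other three equations use the same exchange.
    linear_combination (f x t * Complex.I) * b₁ - (ht x t * Complex.I) * b₃
  · rintro x t ⟨h₁, h₂⟩
    simp only at h₁ h₂
    have b₁ := H.B2 x t
    have b₃ := H.B3 x t
    rw [hirotaD_zero_one] at b₁ b₃
    rw [dt_div H.smooth_hb H.smooth_s h₂]
    field_simp
    linear_combination (s x t * Complex.I) * b₁ + (hb x t * Complex.I) * b₃
  · rintro x t ⟨h₁, h₂⟩
    simp only at h₁ h₂
    have b₁ := H.B4 x t
    have b₃ := H.B6 x t
    rw [hirotaD_one_zero] at b₁ b₃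
    rw [dx_div H.smooth_g H.smooth_s _ h₂]
    field_simp
    linear_combination (-s x t) * b₁ - (g x t) * b₃ +
      (dx g x t * s x t * f x t - g x t * dx s x t * f x t) * I2
  · rintro x t ⟨h₁, h₂⟩
    simp only at h₁ h₂
    have b₁ := H.B5 x t
    have b₃ := H.B6 x t
    rw [hirotaD_one_zero] at b₁ b₃
    rw [dx_div H.smooth_h H.smooth_f _ h₁]
    field_simp
    linear_combination (f x t) * b₁ - (h x t) * b₃ -
      (dx h x t * f x t * s x t - h x t * dx f x t * s x t) * I2


/-! ### Elementary vectors and their modes -/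

theorem hasDerivAt_mulVec (B : Matrix (Fin K) (Fin K) ℂ) {f : ℝ → Fin K → ℂ} {f' : Fin K → ℂ}
    {y : ℝ} (h : HasDerivAt f f' y) : HasDerivAt (fun y => B *ᵥ f y) (B *ᵥ f') y :=
  ((B.mulVecLin.toContinuousLinearMap.restrictScalars ℝ).hasFDerivAt (x := f y)).comp_hasDerivAt y h

theorem Smooth.mulVec (B : Matrix (Fin K) (Fin K) ℂ) {φ : ℝ → ℝ → Fin K → ℂ} (h : Smooth φ) :
    Smooth fun x t => B *ᵥ φ x t :=
  ContDiff.comp (B.mulVecLin.toContinuousLinearMap.restrictScalars ℝ).contDiff h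

section elementary

variable {c : ℂ} {A L : Matrix (Fin K) (Fin K) ℂ} {φ : ℝ → ℝ → Fin K → ℂ}

theorem IsElementary.hasDerivAt_x (h : IsElementary c A φ) (hL : L = c • A ^ 2) (x t : ℝ) :
    HasDerivAt (fun y => φ y t) (L *ᵥ φ x t) x := by
  rw [hL, Matrix.smul_mulVec]; exact h.x_eq x t

/-- A priori Φ is known only up to a function of t. Comparing φ_xt = -LΦ/4 with φ_tx = -φ/4 gives LΦ
= φ and removes this freedom. -/
theorem IsElementary.hasDerivAt_t (h : IsElementary c A φ) (hL : L = c • A ^ 2)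
    (hdet : IsUnit L.det) (x t : ℝ) :
    HasDerivAt (fun τ => φ x τ) (-(1 / 4 : ℂ) • (L⁻¹ *ᵥ φ x t)) t := by
  obtain ⟨Φ, hΦ, ht⟩ := h.t_eq
  have key := h.smooth.mixed_partials (h.hasDerivAt_x hL) ht (hasDerivAt_mulVec L (ht x t))
    ((hΦ x t).const_smul (-(1 / 4 : ℂ)))
  have e : L⁻¹ *ᵥ φ x t = Φ x t := by
    rw [Matrix.mulVec_smul] at key
    have := smul_right_injective (Fin K → ℂ) (show (-(1 / 4 : ℂ)) ≠ 0 by norm_num) key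
    rw [← this, Matrix.mulVec_mulVec, Matrix.nonsing_inv_mul _ hdet, Matrix.one_mulVec]
  rw [e]; exact ht x t

theorem IsElementary.iteratedDeriv_eq (h : IsElementary c A φ) (hL : L = c • A ^ 2) (k : ℕ)
    (x t : ℝ) : iteratedDeriv k (fun y => φ y t) x = L ^ k *ᵥ φ x t := by
  induction k generalizing x with
  | zero => simp
  | succ k ih =>
    rw [iteratedDeriv_succ, funext ih,
      (hasDerivAt_mulVec (L ^ k) (h.hasDerivAt_x hL x t)).deriv, Matrix.mulVec_mulVec, pow_succ]

end elementary

/-- The vectors `L ^ j φ` for `j : ℤ`. -/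
def modes (L : Matrix (Fin K) (Fin K) ℂ) (w : Fin K → ℂ) (j : ℤ) : Fin K → ℂ := L ^ j *ᵥ w

theorem mulVec_modes {L : Matrix (Fin K) (Fin K) ℂ} (hL : IsUnit L.det) (w : Fin K → ℂ) (j : ℤ) :
    L *ᵥ modes L w j = modes L w (j + 1) := by
  rw [modes, modes, Matrix.mulVec_mulVec, add_comm, Matrix.zpow_one_add hL]

theorem inv_mulVec_modes {L : Matrix (Fin K) (Fin K) ℂ} (hL : IsUnit L.det) (w : Fin K → ℂ)
    (j : ℤ) : L⁻¹ *ᵥ modes L w j = modes L w (j - 1) := by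
  have := mulVec_modes hL w (j - 1)
  rw [sub_add_cancel] at this
  rw [← this, Matrix.mulVec_mulVec, Matrix.nonsing_inv_mul _ hL, Matrix.one_mulVec]

theorem modes_mulVec {L : Matrix (Fin K) (Fin K) ℂ} (hL : IsUnit L.det) (w : Fin K → ℂ) (j : ℤ) :
    modes L (L *ᵥ w) j = L *ᵥ modes L w j := by
  rw [mulVec_modes hL, modes, modes, Matrix.mulVec_mulVec, Matrix.zpow_add_one hL]

theorem modes_inv_mulVec {L : Matrix (Fin K) (Fin K) ℂ} (hL : IsUnit L.det) (w : Fin K → ℂ)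
    (j : ℤ) : modes L (L⁻¹ *ᵥ w) j = L⁻¹ *ᵥ modes L w j := by
  rw [inv_mulVec_modes hL, modes, modes, Matrix.mulVec_mulVec, Matrix.zpow_sub_one hL]

section tau

variable {A L : Matrix (Fin K) (Fin K) ℂ} {φ ψ : ℝ → ℝ → Fin K → ℂ}

theorem doubleWronskian_eq_columnDet {c c' : ℂ} {L' : Matrix (Fin K) (Fin K) ℂ}
    (hφ : IsElementary c A φ) (hψ : IsElementary c' A ψ) (hL : L = c • A ^ 2)
    (hL' : L' = c' • A ^ 2) (a p b q : ℕ) (hK : p + q = K) :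
    doubleWronskian φ ψ a p b = fun x t =>
      columnDet (segment (modes L (φ x t)) a p ++ segment (modes L' (ψ x t)) b q) := by
  funext x t
  unfold doubleWronskian columnDet
  congr 1
  ext i j
  simp only [Matrix.of_apply]
  rw [getD_segment_append_segment _ _ _ _ _ _ _ (by omega)]
  split_ifs with h
  · rw [hφ.iteratedDeriv_eq hL, modes]
    norm_cast
  · rw [hψ.iteratedDeriv_eq hL', modes]
    norm_cast

theorem Smooth.columnDet_segment {u v : ℝ → ℝ → ℤ → Fin K → ℂ}
    (hu : ∀ j, Smooth fun x t => u x t j) (hv : ∀ j, Smooth fun x t => v x t j)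
    (a b : ℤ) (p q : ℕ) (hK : p + q = K) :
    Smooth fun x t => columnDet (segment (u x t) a p ++ segment (v x t) b q) := by
  unfold Smooth columnDet
  simp only [Matrix.det_apply']
  refine ContDiff.sum fun σ _ => contDiff_const.mul (contDiff_prod fun i _ => ?_)
  simp only [Matrix.of_apply, getD_segment_append_segment _ _ a b p q i (by omega)]
  split_ifs
  · exact contDiff_pi.1 (hu _) _
  · exact contDiff_pi.1 (hv _) _

end tau

/-! ### The bilinear equations for the tau functions -/

theorem Smooth.const_mul {u : ℝ → ℝ → ℂ} (h : Smooth u) (c : ℂ) : Smooth fun x t => c * u x t :=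
  contDiff_const.mul h

theorem dx_const_mul (c : ℂ) (u : ℝ → ℝ → ℂ) (x t : ℝ) :
    dx (fun x t => c * u x t) x t = c * dx u x t := deriv_const_mul_field c

theorem dt_const_mul (c : ℂ) (u : ℝ → ℝ → ℂ) (x t : ℝ) :
    dt (fun x t => c * u x t) x t = c * dt u x t := deriv_const_mul_field c

/-- With N = n + 1 and M = m + 1, each equation is a constant multiple of one of the six identities:
both factors are differentiated on the same side, so their trace terms cancel. -/
theorem isBilinearSolution_tau (n m : ℕ)
    {A : Matrix (Fin (n + 1 + (m + 1))) (Fin (n + 1 + (m + 1))) ℂ} (hA : IsUnit A)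
    {φ ψ : ℝ → ℝ → Fin (n + 1 + (m + 1)) → ℂ} (hφ : IsElementary (Complex.I / 2) A φ)
    (hψ : IsElementary (-(Complex.I / 2)) A ψ) :
    IsBilinearSolution (tauF (n + 1) (m + 1) φ ψ) (tauG (n + 1) (m + 1) A φ ψ)
      (tauH (n + 1) (m + 1) A φ ψ) (tauS (n + 1) (m + 1) φ ψ) (tauHt (n + 1) (m + 1) A φ ψ)
      (tauHb (n + 1) (m + 1) A φ ψ) := by
  obtain ⟨L, hL⟩ : ∃ L, L = (Complex.I / 2) • A ^ 2 := ⟨_, rfl⟩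
  have hL' : -L = (-(Complex.I / 2)) • A ^ 2 := by rw [hL, neg_smul]
  have hdA : A.det ≠ 0 := ((Matrix.isUnit_iff_isUnit_det _).1 hA).ne_zero
  have hdL : L.det ≠ 0 := by
    rw [hL, Matrix.det_smul, Matrix.det_pow]
    exact mul_ne_zero (pow_ne_zero _ (by simp)) (pow_ne_zero _ hdA)
  have hdL' : (-L).det ≠ 0 := by
    rw [Matrix.det_neg]
    exact mul_ne_zero (pow_ne_zero _ (by simp)) hdL
  have huL := hdL.isUnit
  have huL' := hdL'.isUnit
  have hinv : (-L)⁻¹ = -L⁻¹ := Matrix.inv_eq_right_inv (by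
    rw [neg_mul_neg, Matrix.mul_nonsing_inv _ huL])
  set u : ℝ → ℝ → ℤ → Fin (n + 1 + (m + 1)) → ℂ := fun x t => modes L (φ x t) with hu
  set v : ℝ → ℝ → ℤ → Fin (n + 1 + (m + 1)) → ℂ := fun x t => modes (-L) (ψ x t) with hv
  have hLu : ∀ x t j, L *ᵥ u x t j = u x t (j + 1) := fun x t => mulVec_modes huL _
  have hLv : ∀ x t j, L *ᵥ v x t j = -v x t (j + 1) := fun x t j => by
    simp only [hv]
    rw [← mulVec_modes huL', Matrix.neg_mulVec, neg_neg]
  -- `T` generates the t-flow of the u-modes, and `-T` that of the v-modes because (-L)⁻¹ = -L⁻¹.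
  set T : Matrix (Fin (n + 1 + (m + 1))) (Fin (n + 1 + (m + 1))) ℂ := (-(1 / 4) : ℂ) • L⁻¹ with hT
  have hTu : ∀ x t j, T *ᵥ u x t j = (-(1 / 4) : ℂ) • u x t (j - 1) := fun x t j => by
    rw [hT, Matrix.smul_mulVec, hu, inv_mulVec_modes huL]
  have hTv : ∀ x t j, T *ᵥ v x t j = -(-(1 / 4) : ℂ) • v x t (j - 1) := fun x t j => by
    simp only [hv]
    rw [hT, Matrix.smul_mulVec, ← inv_mulVec_modes huL', hinv, Matrix.neg_mulVec, smul_neg,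
      neg_smul, neg_neg]
  have hux : ∀ x t j, HasDerivAt (fun y => u y t j) (L *ᵥ u x t j) x := fun x t j => by
    rw [hu, ← modes_mulVec huL]
    exact hasDerivAt_mulVec _ (hφ.hasDerivAt_x hL x t)
  have hvx : ∀ x t j, HasDerivAt (fun y => v y t j) (-(L *ᵥ v x t j)) x := fun x t j => by
    rw [hv, ← Matrix.neg_mulVec, ← modes_mulVec huL']
    exact hasDerivAt_mulVec _ (hψ.hasDerivAt_x hL' x t)
  have hut : ∀ x t j, HasDerivAt (fun τ => u x τ j) (T *ᵥ u x t j) t := fun x t j => by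
    rw [hu, hT, Matrix.smul_mulVec, ← modes_inv_mulVec huL, modes, ← Matrix.mulVec_smul]
    exact hasDerivAt_mulVec _ (hφ.hasDerivAt_t hL huL x t)
  have hvt : ∀ x t j, HasDerivAt (fun τ => v x τ j) (-(T *ᵥ v x t j)) t := fun x t j => by
    rw [hv, hT, Matrix.smul_mulVec, ← smul_neg, ← Matrix.neg_mulVec, ← hinv,
      ← modes_inv_mulVec huL', modes, ← Matrix.mulVec_smul]
    exact hasDerivAt_mulVec _ (hψ.hasDerivAt_t hL' huL' x t)
  set W : ℤ → ℕ → ℤ → ℕ → ℝ → ℝ → ℂ := fun a p b q x t =>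
    columnDet (segment (u x t) a p ++ segment (v x t) b q) with hWdef
  have hW : ∀ a p b q : ℕ, p + q = n + 1 + (m + 1) → doubleWronskian φ ψ a p b = W a p b q :=
    fun a p b q h => doubleWronskian_eq_columnDet hφ hψ hL hL' a p b q h
  have hsm : ∀ a p b q, p + q = n + 1 + (m + 1) → Smooth (W a p b q) := fun a p b q h =>
    Smooth.columnDet_segment (fun j => hφ.smooth.mulVec _) (fun j => hψ.smooth.mulVec _) a b p q h
  have hf : tauF (n + 1) (m + 1) φ ψ = W 1 (n + 1) 0 (m + 1) := by
    simpa [tauF, tauS] using hW 1 (n + 1) 0 (m + 1) rfl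
  have hs : tauS (n + 1) (m + 1) φ ψ = W 1 (n + 1) 1 (m + 1) := by
    simpa [tauF, tauS] using hW 1 (n + 1) 1 (m + 1) rfl
  obtain ⟨w, hw, hw0⟩ : ∃ w, (2 * Complex.I) ^ n = w ∧ w ≠ 0 :=
    ⟨_, rfl, pow_ne_zero _ (by simp)⟩
  have hg : tauG (n + 1) (m + 1) A φ ψ = fun x t =>
      (1 / (2 * w) * A.det) * W 0 (n + 2) 1 m x t := by
    funext x t
    rw [tauG, add_tsub_cancel_right, hw, hW 0 (n + 2) 1 m (by omega)]
    norm_cast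
  have hh : tauH (n + 1) (m + 1) A φ ψ = fun x t =>
      (-Complex.I * w * A.det⁻¹) * W 2 n 0 (m + 2) x t := by
    funext x t
    rw [tauH, add_tsub_cancel_right, hw, hW 2 n 0 (m + 2) (by omega)]
    norm_cast
  have hht : tauHt (n + 1) (m + 1) A φ ψ = fun x t =>
      (-(1 / w) * A.det) * W 0 (n + 2) 0 m x t := by
    funext x t
    rw [tauHt, add_tsub_cancel_right, hw, hW 0 (n + 2) 0 m (by omega)]
    norm_cast
  have hhb : tauHb (n + 1) (m + 1) A φ ψ = fun x t =>
      (-(w * (2 * Complex.I)) * A.det⁻¹) * W 2 n 1 (m + 2) x t := by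
    funext x t
    rw [tauHb, add_tsub_cancel_right, pow_succ, hw, hW 2 n 1 (m + 2) (by omega)]
    norm_cast
  have top_left : ∀ a p b q x t, p + 1 + q = n + 1 + (m + 1) → dx (W a (p + 1) b q) x t =
      -L.trace * W a (p + 1) b q x t +
        2 * columnDet (segment (u x t) a p ++ u x t (a + p + 1) :: segment (v x t) b q) := by
    intro a p b q x t h
    have := hasDerivAt_columnDet_top_left (hux x t) (hvx x t) (r := 1)
      (by simpa using hLu x t) a b p q h
    rw [mul_one] at this
    exact this.deriv
  have top_right : ∀ a p b q x t, p + (q + 1) = n + 1 + (m + 1) → dx (W a p b (q + 1)) x t =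
      L.trace * W a p b (q + 1) x t +
        2 * columnDet (segment (u x t) a p ++
          (segment (v x t) b q ++ [v x t (b + q + 1)])) := by
    intro a p b q x t h
    have := hasDerivAt_columnDet_top_right (hux x t) (hvx x t) (r := 1)
      (by simpa using hLv x t) a b p q h
    rw [mul_one] at this
    exact this.deriv
  have bottom_left : ∀ a p b q x t, p + 1 + q = n + 1 + (m + 1) → dt (W a (p + 1) b q) x t =
      -T.trace * W a (p + 1) b q x t + 2 * -(1 / 4) * columnDet
        (u x t (a - 1) :: (segment (u x t) (a + 1) p ++ segment (v x t) b q)) :=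
    fun a p b q x t h => (hasDerivAt_columnDet_bottom_left (u := fun y => u x y)
      (v := fun y => v x y) (hut x t) (hvt x t) (hTu x t) a b p q h).deriv
  have bottom_right : ∀ a p b q x t, p + (q + 1) = n + 1 + (m + 1) → dt (W a p b (q + 1)) x t =
      T.trace * W a p b (q + 1) x t + 2 * -(1 / 4) * columnDet
        (segment (u x t) a p ++ v x t (b - 1) :: segment (v x t) (b + 1) q) :=
    fun a p b q x t h => (hasDerivAt_columnDet_bottom_right (u := fun y => u x y)
      (v := fun y => v x y) (hut x t) (hvt x t) (hTv x t) a b p q h).deriv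
  have hK : n + m + 2 = n + 1 + (m + 1) := by omega
  have two : (1 : ℤ) + 1 = 2 := rfl
  rw [hf, hg, hh, hs, hht, hhb]
  refine ⟨hsm _ _ _ _ rfl, (hsm _ _ _ _ (by omega)).const_mul _,
    (hsm _ _ _ _ (by omega)).const_mul _, hsm _ _ _ _ rfl, (hsm _ _ _ _ (by omega)).const_mul _,
    (hsm _ _ _ _ (by omega)).const_mul _, ?_, ?_, ?_, ?_, ?_, ?_⟩ <;> intro x t
  · have key := bilinear_ht_s_bottom L (u x t) (v x t) (hLu x t) (hLv x t) hK
    have d₁ := bottom_left 0 (n + 1) 0 m x t (by omega)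
    have d₂ := bottom_left 1 n 1 (m + 1) x t rfl
    simp only [zero_sub, zero_add, sub_self, two] at d₁ d₂
    rw [hirotaD_zero_one, dt_const_mul, d₁, d₂]
    simp only [hWdef]
    linear_combination (1 / w * A.det / 2) * key
  · have key := bilinear_hb_f_bottom L (u x t) (v x t) (hLu x t) (hLv x t) hK hdL
    have d₁ := bottom_right 2 n 1 (m + 1) x t (by omega)
    have d₂ := bottom_right 1 (n + 1) 0 m x t rfl
    simp only [zero_sub, zero_add, sub_self, one_add_one_eq_two] at d₁ d₂
    rw [hirotaD_zero_one, dt_const_mul, d₁, d₂]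
    simp only [hWdef]
    linear_combination (w * Complex.I * A.det⁻¹) * key
  · have key := bilinear_f_s_bottom hK (u x t) (v x t)
    have d₁ := bottom_left 1 n 0 (m + 1) x t rfl
    have d₂ := bottom_left 1 n 1 (m + 1) x t rfl
    simp only [sub_self, two] at d₁ d₂
    rw [hirotaD_zero_one, d₁, d₂]
    simp only [hWdef]
    -- The prefactors of g and h are reciprocal in |A| and in (2i)^n, so both drop out of the
    -- product gh.
    have e : Complex.I * (1 / (2 * w) * A.det) * (-Complex.I * w * A.det⁻¹) = 1 / 2 := by
      field_simp
      simp
    linear_combination (-1 / 2) * key +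
      columnDet (segment (u x t) 0 (n + 2) ++ segment (v x t) 1 m) *
        columnDet (segment (u x t) 2 n ++ segment (v x t) 0 (m + 2)) * e
  · have key := bilinear_g_f_top L (u x t) (v x t) (hLu x t) (hLv x t) hK
    have d₁ := top_left 0 (n + 1) 1 m x t (by omega)
    have d₂ := top_left 1 n 0 (m + 1) x t rfl
    simp only [zero_add, Nat.cast_succ] at d₁ d₂
    rw [hirotaD_one_zero, dx_const_mul, d₁, d₂]
    simp only [hWdef]
    linear_combination (1 / w * A.det) * key
  · have key := bilinear_h_s_top hK (u x t) (v x t)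
    have d₁ := top_right 2 n 0 (m + 1) x t (by omega)
    have d₂ := top_right 1 (n + 1) 1 m x t rfl
    simp only [zero_add, Nat.cast_succ] at d₁ d₂
    rw [hirotaD_one_zero, dx_const_mul, d₁, d₂]
    simp only [hWdef]
    linear_combination (-2 * Complex.I * w * A.det⁻¹) * key
  · have key := bilinear_f_s_top L (u x t) (v x t) (hLu x t) (hLv x t) hK
    have d₁ := top_left 1 n 0 (m + 1) x t rfl
    have d₂ := top_left 1 n 1 (m + 1) x t rfl
    rw [hirotaD_one_zero, d₁, d₂]
    simp only [hWdef]
    have e : Complex.I * (-(1 / w) * A.det) * (-(w * (2 * Complex.I)) * A.det⁻¹) = -2 := by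
      field_simp
      simp
    linear_combination 2 * key -
      columnDet (segment (u x t) 0 (n + 2) ++ segment (v x t) 0 m) *
        columnDet (segment (u x t) 2 n ++ segment (v x t) 1 (m + 2)) * e


/-! ### Exponential solutions of the linear conditions -/

section exponential

theorem hasDerivAt_exp_smul_add_mulVec {L S : Matrix (Fin K) (Fin K) ℂ} (h : Commute L S)
    (w : Fin K → ℂ) (x : ℝ) :
    HasDerivAt (fun y : ℝ => NormedSpace.exp (y • L + S) *ᵥ w)
      (L *ᵥ (NormedSpace.exp (x • L + S) *ᵥ w)) x := by
  have hc : ∀ y : ℝ, NormedSpace.exp (y • L + S) = NormedSpace.exp (y • L) * NormedSpace.exp S :=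
    fun y => Matrix.exp_add_of_commute _ _ (h.smul_left y)
  simp only [hc]
  rw [Matrix.mulVec_mulVec, ← Matrix.mul_assoc]
  -- An auxiliary algebra norm, used only to differentiate the exponential.
  let _ : NormedRing (Matrix (Fin K) (Fin K) ℂ) := Matrix.linftyOpNormedRing
  let _ : NormedAlgebra ℝ (Matrix (Fin K) (Fin K) ℂ) := Matrix.linftyOpNormedAlgebra
  have hd : HasDerivAt (fun y : ℝ => NormedSpace.exp (y • L)) (L * NormedSpace.exp (x • L)) x :=
    hasDerivAt_exp_smul_const' L x
  have hm := hd.mul_const (NormedSpace.exp S)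
  let ev : Matrix (Fin K) (Fin K) ℂ →ₗ[ℝ] (Fin K → ℂ) :=
    { toFun := fun M => M *ᵥ w
      map_add' := fun M M' => Matrix.add_mulVec M M' w
      map_smul' := fun r M => Matrix.smul_mulVec r M w }
  exact (LinearMap.toContinuousLinearMap ev).hasFDerivAt.comp_hasDerivAt x hm

theorem smooth_exp_mulVec (L S : Matrix (Fin K) (Fin K) ℂ) (w : Fin K → ℂ) :
    Smooth fun x t => NormedSpace.exp (x • L + t • S) *ᵥ w := by
  let _ : NormedRing (Matrix (Fin K) (Fin K) ℂ) := Matrix.linftyOpNormedRing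
  let _ : NormedAlgebra ℝ (Matrix (Fin K) (Fin K) ℂ) := Matrix.linftyOpNormedAlgebra
  let ev : Matrix (Fin K) (Fin K) ℂ →ₗ[ℝ] (Fin K → ℂ) :=
    { toFun := fun M => M *ᵥ w
      map_add' := fun M M' => Matrix.add_mulVec M M' w
      map_smul' := fun r M => Matrix.smul_mulVec r M w }
  have he : ContDiff ℝ ∞ (NormedSpace.exp : Matrix (Fin K) (Fin K) ℂ → _) :=
    contDiff_iff_contDiffAt.2 fun M => (NormedSpace.exp_analytic (𝕂 := ℝ) M).contDiffAt
  have hl : ContDiff ℝ ∞ fun p : ℝ × ℝ => p.1 • L + p.2 • S :=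
    (contDiff_fst.smul contDiff_const).add (contDiff_snd.smul contDiff_const)
  exact (LinearMap.toContinuousLinearMap ev).contDiff.comp (he.comp hl)

/-- The coefficient of t is forced: Φ = (cA²)⁻¹φ is an x-antiderivative, so φ_t = -Φ/4. For c = ±i/2
it equals ±i/2 again. -/
theorem isElementary_exp {c : ℂ} (hc : c ≠ 0) {A : Matrix (Fin K) (Fin K) ℂ} (hA : IsUnit A)
    (w : Fin K → ℂ) :
    IsElementary c A fun x t =>
      NormedSpace.exp (x • (c • A ^ 2) + t • ((-(1 / 4) * c⁻¹) • A⁻¹ ^ 2)) *ᵥ w := by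
  have hdet := (Matrix.isUnit_iff_isUnit_det _).1 hA
  have hcomm : Commute A A⁻¹ := by
    rw [commute_iff_eq, Matrix.mul_nonsing_inv _ hdet, Matrix.nonsing_inv_mul _ hdet]
  have hLS : Commute (c • A ^ 2) ((-(1 / 4) * c⁻¹) • A⁻¹ ^ 2) :=
    ((hcomm.pow_pow 2 2).smul_left c).smul_right _
  have hinv : A ^ 2 * A⁻¹ ^ 2 = 1 := by
    rw [← hcomm.mul_pow, Matrix.mul_nonsing_inv _ hdet, one_pow]
  refine ⟨smooth_exp_mulVec _ _ _, fun x t => ?_, fun x t => (c⁻¹ • A⁻¹ ^ 2) *ᵥ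
    (NormedSpace.exp (x • (c • A ^ 2) + t • ((-(1 / 4) * c⁻¹) • A⁻¹ ^ 2)) *ᵥ w), fun x t => ?_,
    fun x t => ?_⟩
  · rw [← Matrix.smul_mulVec]
    exact hasDerivAt_exp_smul_add_mulVec (hLS.smul_right t) w x
  · refine (hasDerivAt_mulVec _
      (hasDerivAt_exp_smul_add_mulVec (hLS.smul_right t) w x)).congr_deriv ?_
    have hinv' : A⁻¹ ^ 2 * A ^ 2 = 1 := by rw [← hcomm.symm.mul_pow,
      Matrix.nonsing_inv_mul _ hdet, one_pow]
    rw [Matrix.mulVec_mulVec, smul_mul_smul_comm, hinv', inv_mul_cancel₀ hc, one_smul,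
      Matrix.one_mulVec]
  · rw [← Matrix.smul_mulVec, smul_smul]
    have := hasDerivAt_exp_smul_add_mulVec (hLS.symm.smul_right x) w t
    simpa only [add_comm] using this

theorem phi_eq (A : Matrix (Fin K) (Fin K) ℂ) (C : Fin K → ℂ) :
    phi A C = fun (x t : ℝ) => NormedSpace.exp (x • ((Complex.I / 2) • A ^ 2) +
      t • ((-(1 / 4) * (Complex.I / 2)⁻¹) • A⁻¹ ^ 2)) *ᵥ C := by
  have e : -(1 / 4) * (Complex.I / 2)⁻¹ = Complex.I / 2 := by
    rw [inv_div, ← mul_div_assoc, div_eq_iff Complex.I_ne_zero]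
    linear_combination (-1 / 2) * Complex.I_mul_I
  funext x t
  rw [e, phi]
  congr 2
  ext i j
  simp
  ring

theorem psi_eq (A : Matrix (Fin K) (Fin K) ℂ) (B : Fin K → ℂ) :
    psi A B = fun (x t : ℝ) => NormedSpace.exp (x • ((-(Complex.I / 2)) • A ^ 2) +
      t • ((-(1 / 4) * (-(Complex.I / 2))⁻¹) • A⁻¹ ^ 2)) *ᵥ B := by
  have e : -(1 / 4) * (-(Complex.I / 2))⁻¹ = -(Complex.I / 2) := by
    rw [inv_neg, inv_div, mul_neg, ← mul_div_assoc, neg_inj, div_eq_iff Complex.I_ne_zero]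
    linear_combination (-1 / 2) * Complex.I_mul_I
  funext x t
  rw [e, psi]
  congr 2
  ext i j
  simp
  ring

theorem isElementary_phi {A : Matrix (Fin K) (Fin K) ℂ} (hA : IsUnit A) (C : Fin K → ℂ) :
    IsElementary (Complex.I / 2) A (phi A C) := by
  rw [phi_eq]; exact isElementary_exp (by simp) hA C

theorem isElementary_psi {A : Matrix (Fin K) (Fin K) ℂ} (hA : IsUnit A) (B : Fin K → ℂ) :
    IsElementary (-(Complex.I / 2)) A (psi A B) := by
  rw [psi_eq]; exact isElementary_exp (by simp) hA B

end exponential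

/-! ### Invariance under similarity -/

section similarity

variable {P : Matrix (Fin K) (Fin K) ℂ} (hP : IsUnit P) (A : Matrix (Fin K) (Fin K) ℂ)

include hP

theorem conj_pow_two : (P * A * P⁻¹) ^ 2 = P * A ^ 2 * P⁻¹ := by
  have hdet := (Matrix.isUnit_iff_isUnit_det _).1 hP
  rw [pow_two, pow_two]
  calc P * A * P⁻¹ * (P * A * P⁻¹) = P * A * (P⁻¹ * P) * A * P⁻¹ := by
        simp only [Matrix.mul_assoc]
    _ = _ := by rw [Matrix.nonsing_inv_mul _ hdet, Matrix.mul_one]; simp only [Matrix.mul_assoc]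

theorem conj_inv : (P * A * P⁻¹)⁻¹ = P * A⁻¹ * P⁻¹ := by
  have hdet := (Matrix.isUnit_iff_isUnit_det _).1 hP
  rw [Matrix.mul_inv_rev, Matrix.mul_inv_rev, Matrix.nonsing_inv_nonsing_inv _ hdet,
    Matrix.mul_assoc]

theorem exp_conj_mulVec (S : Matrix (Fin K) (Fin K) ℂ) (w : Fin K → ℂ) :
    NormedSpace.exp (P * S * P⁻¹) *ᵥ (P *ᵥ w) = P *ᵥ (NormedSpace.exp S *ᵥ w) := by
  have hdet := (Matrix.isUnit_iff_isUnit_det _).1 hP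
  rw [Matrix.exp_conj _ _ hP, Matrix.mulVec_mulVec, Matrix.mulVec_mulVec, Matrix.mul_assoc,
    Matrix.nonsing_inv_mul _ hdet, Matrix.mul_one]

theorem phi_conj (C : Fin K → ℂ) :
    phi (P * A * P⁻¹) (P *ᵥ C) = fun x t => P *ᵥ phi A C x t := by
  funext x t
  rw [phi, phi, conj_inv hP, conj_pow_two hP, conj_pow_two hP, ← exp_conj_mulVec hP]
  simp only [Matrix.mul_add, Matrix.add_mul, Matrix.mul_smul, Matrix.smul_mul]

theorem psi_conj (B : Fin K → ℂ) :
    psi (P * A * P⁻¹) (P *ᵥ B) = fun x t => P *ᵥ psi A B x t := by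
  funext x t
  rw [psi, psi, conj_inv hP, conj_pow_two hP, conj_pow_two hP, ← exp_conj_mulVec hP]
  simp only [Matrix.mul_sub, Matrix.sub_mul, Matrix.mul_smul, Matrix.smul_mul, Matrix.mul_neg,
    Matrix.neg_mul]

omit hP in
theorem iteratedDeriv_mulVec {φ : ℝ → Fin K → ℂ} (h : ContDiff ℝ ∞ φ) (k : ℕ) (x : ℝ) :
    iteratedDeriv k (fun y => P *ᵥ φ y) x = P *ᵥ iteratedDeriv k φ x := by
  induction k generalizing x with
  | zero => simp
  | succ k ih =>
    rw [iteratedDeriv_succ, iteratedDeriv_succ, funext ih]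
    exact (hasDerivAt_mulVec P
      (h.differentiable_iteratedDeriv k (by exact_mod_cast WithTop.coe_lt_top _) x).hasDerivAt).deriv

omit hP in
theorem doubleWronskian_mulVec {φ ψ : ℝ → ℝ → Fin K → ℂ} (hφ : Smooth φ) (hψ : Smooth ψ)
    (a p b : ℕ) (x t : ℝ) :
    doubleWronskian (fun x t => P *ᵥ φ x t) (fun x t => P *ᵥ ψ x t) a p b x t =
      P.det * doubleWronskian φ ψ a p b x t := by
  have hx : ∀ {u : ℝ → ℝ → Fin K → ℂ}, Smooth u → ContDiff ℝ ∞ fun y => u y t := fun h =>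
    ContDiff.comp (g := fun p : ℝ × ℝ => _) h (contDiff_id.prodMk contDiff_const)
  unfold doubleWronskian
  rw [← Matrix.det_mul]
  congr 1
  ext i j
  simp only [Matrix.of_apply, iteratedDeriv_mulVec (hx hφ), iteratedDeriv_mulVec (hx hψ),
    Matrix.mul_apply, Matrix.mulVec, dotProduct]
  split_ifs <;> rfl

end similarity

/-- Every Wronskian acquires the same nonzero factor det P, and |A| is a similarity invariant; so
the zero sets and all quotients are unchanged. Only smoothness of φ and ψ is needed. -/
theorem q_conj (N M : ℕ) {A P : Matrix (Fin (N + M)) (Fin (N + M)) ℂ} (hP : IsUnit P)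
    {φ ψ : ℝ → ℝ → Fin (N + M) → ℂ} (hφ : Smooth φ) (hψ : Smooth ψ) :
    domain N M (fun x t => P *ᵥ φ x t) (fun x t => P *ᵥ ψ x t) = domain N M φ ψ ∧
    q₁ N M (P * A * P⁻¹) (fun x t => P *ᵥ φ x t) (fun x t => P *ᵥ ψ x t) = q₁ N M A φ ψ ∧
    q₂ N M (P * A * P⁻¹) (fun x t => P *ᵥ φ x t) (fun x t => P *ᵥ ψ x t) = q₂ N M A φ ψ ∧
    q₃ N M (P * A * P⁻¹) (fun x t => P *ᵥ φ x t) (fun x t => P *ᵥ ψ x t) = q₃ N M A φ ψ ∧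
    q₄ N M (P * A * P⁻¹) (fun x t => P *ᵥ φ x t) (fun x t => P *ᵥ ψ x t) = q₄ N M A φ ψ := by
  have hdP := (Matrix.isUnit_iff_isUnit_det _).1 hP
  have hA : (P * A * P⁻¹).det = A.det := Matrix.det_conj hP A
  have hW := fun a p b x t => doubleWronskian_mulVec (P := P) hφ hψ a p b x t
  have hdiv : ∀ c w z : ℂ, c * (P.det * w) / (P.det * z) = c * w / z := fun c w z => by
    rw [mul_left_comm, mul_div_mul_left _ _ hdP.ne_zero]
  refine ⟨?_, ?_, ?_, ?_, ?_⟩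
  · ext p
    simp only [domain, tauF, tauS, hW, Set.mem_ofPred_eq, ne_eq, mul_eq_zero, hdP.ne_zero,
      false_or]
  all_goals
    funext x t
    simp only [q₁, q₂, q₃, q₄, tauF, tauS, tauG, tauH, tauHt, tauHb, hW, hA, hdiv]

end MTM

end

theorem mainTheorem1 (N M : ℕ) (hN : 1 ≤ N) (hM : 1 ≤ M)
    (A : Matrix (Fin (N + M)) (Fin (N + M)) ℂ) (hA : IsUnit A) :
    -- double Wronskians of elementary vectors solve the bilinear equations and give `q₁, …, q₄`
    (∀ φ ψ : ℝ → ℝ → Fin (N + M) → ℂ,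
      MTM.IsElementary (Complex.I / 2) A φ → MTM.IsElementary (-(Complex.I / 2)) A ψ →
        MTM.IsBilinearSolution (MTM.tauF N M φ ψ) (MTM.tauG N M A φ ψ) (MTM.tauH N M A φ ψ)
          (MTM.tauS N M φ ψ) (MTM.tauHt N M A φ ψ) (MTM.tauHb N M A φ ψ) ∧
        MTM.IsMTMSolutionOn (MTM.domain N M φ ψ) (MTM.q₁ N M A φ ψ) (MTM.q₂ N M A φ ψ)
          (MTM.q₃ N M A φ ψ) (MTM.q₄ N M A φ ψ)) ∧
    -- the explicit exponential vectors are elementary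
    (∀ B C : Fin (N + M) → ℂ,
      MTM.IsElementary (Complex.I / 2) A (MTM.phi A C) ∧
        MTM.IsElementary (-(Complex.I / 2)) A (MTM.psi A B)) ∧
    -- every matrix similar to `A`, with the constant vectors transformed accordingly,
    -- gives the same `q₁, …, q₄` on the same domain
    (∀ P A' : Matrix (Fin (N + M)) (Fin (N + M)) ℂ, IsUnit P → A' = P * A * P⁻¹ →
      ∀ B C : Fin (N + M) → ℂ,
        MTM.domain N M (MTM.phi A' (P *ᵥ C)) (MTM.psi A' (P *ᵥ B)) =
          MTM.domain N M (MTM.phi A C) (MTM.psi A B) ∧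
        MTM.q₁ N M A' (MTM.phi A' (P *ᵥ C)) (MTM.psi A' (P *ᵥ B)) =
          MTM.q₁ N M A (MTM.phi A C) (MTM.psi A B) ∧
        MTM.q₂ N M A' (MTM.phi A' (P *ᵥ C)) (MTM.psi A' (P *ᵥ B)) =
          MTM.q₂ N M A (MTM.phi A C) (MTM.psi A B) ∧
        MTM.q₃ N M A' (MTM.phi A' (P *ᵥ C)) (MTM.psi A' (P *ᵥ B)) =
          MTM.q₃ N M A (MTM.phi A C) (MTM.psi A B) ∧
        MTM.q₄ N M A' (MTM.phi A' (P *ᵥ C)) (MTM.psi A' (P *ᵥ B)) =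
          MTM.q₄ N M A (MTM.phi A C) (MTM.psi A B)) := by
  refine ⟨fun φ ψ hφ hψ => ?_, fun B C => ⟨MTM.isElementary_phi hA C, MTM.isElementary_psi hA B⟩,
    fun P A' hP hA' B C => ?_⟩
  · obtain ⟨n, rfl⟩ := Nat.exists_eq_add_of_le' hN
    obtain ⟨m, rfl⟩ := Nat.exists_eq_add_of_le' hM
    have H := MTM.isBilinearSolution_tau n m hA hφ hψ
    exact ⟨H, H.isMTMSolutionOn⟩
  · subst hA'
    rw [MTM.phi_conj hP, MTM.psi_conj hP]
    exact MTM.q_conj N M hP (MTM.isElementary_phi hA C).smooth (MTM.isElementary_psi hA B).smooth
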